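/- **Setting.** Let $X$ be a cellular decomposition, with 1-skeleton $\Gamma$, of a closed connected (possibly non-orientable) surface $\Sigma$. The decomposition is presented combinatorially as a gluing of finitely many polygons along pairs of sides (equivalently, by its flags); loops, multiple edges, vertices of degree one and faces with one or two sides are allowed. Fix the angles (positive, with sum $2\pi$ around each vertex) at which the edges leave the vertices. Let $\pi\colon\widetilde\Sigma\to\Sigma$ be the orientation cover, whose points are the pairs $(p,o)$ with $p\in\Sigma$ and $o$ a local orientation of $\Sigma$ at $p$, equipped with its tautological orientation, and let $\widetilde X$ be the induced decomposition of $\widetilde\Sigma$. Let $\omega\in C^1(X;\mathbb Z_2)$ represent $w_1(\Sigma)$, that is, the local orientation is preserved along a closed path in $\Gamma$ if and only if the path contains an even number of 1-edges (edges $e$ with $\omega(e)=1$; the others are 0-edges). Fix a labelling of the vertices of $\widetilde X$ by signs such that the two vertices $x_+,x_-$ over a vertex $x$ of $X$ have opposite signs, and the endpoints of a lift of $e$ have the same sign if and only if $\omega(e)=0$. Let $D$ be a dimer configuration on $\Gamma$ (a set of edges such that each vertex is an endpoint of exactly one of them, and no loop belongs to it) and let $K$ be an orientation of the edges of $\Gamma$;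 denote by $\widetilde K$ the lift of $K$ to $\widetilde X$. **Kasteleyn curvature.** For a face $f$ of $X$, let $c^K(f)\in\mathbb Z_2$ be the parity of $$n^{\widetilde K}(\partial\widetilde f)+\#\{\text{edges in }\partial\widetilde f\text{ joining two vertices labelled }-\}+1,$$ where $\widetilde f$ is a lift of $f$ to $\widetilde X$, and $n^{\widetilde K}(\partial\widetilde f)$ is the number of edges in the boundary of the oriented face $\widetilde f$ where $\widetilde K$ disagrees with the boundary orientation (edges met twice count twice); this parity does not depend on the lift. $K$ is a *Kasteleyn orientation on $(X,\omega)$* if $c^K(f)=0$ for all faces $f$. **The framing $s=s(\omega,D,K)$** of $T\widetilde\Sigma\times\mathbb R$ over the 1-skeleton $\widetilde X^1$ is the following positive orthonormal framing $(s_1,s_2,s_3)$. At each vertex, $s_1$ is the unit vector pointing along the dimer of $D$ (lifted to $\widetilde X$); at $x_+$, $(s_1,s_2)$ is a positive basis of $T_{x_+}\widetilde\Sigma$ and $s_3=+1$; at $x_-$, $(s_1,s_2)$ is a negative basis of $T_{x_-}\widetilde\Sigma$ and $s_3=-1$. Moving in the direction of $\widetilde K$ along a lift of a 0-edge, first make a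 right-hand rotation (by an angle in $[0,2\pi)$) around $s_3$ until $s_1$ points in the direction of the edge, then a left-handed half twist around $s_3$, finally a right-hand rotation (by an angle in $[0,2\pi)$) around $s_3$ until $s_1$ coincides with its value at the final vertex. Moving in the direction of $\widetilde K$ along a lift of a 1-edge, first make a right-hand rotation (by an angle in $[0,2\pi)$) around $s_3$ until $s_1$ points in the direction of the edge, then a right-handed half twist around $s_2$, finally a left-hand rotation (by an angle in $[0,2\pi)$) around $s_3$ until $s_1$ coincides with its value at the final vertex. Here directions along an edge are measured with respect to the tangent vector of the edge. For a face $\widetilde f$ of $\widetilde X$, fix a constant framing of $T\widetilde\Sigma\times\mathbb R$ over $\widetilde f$; the restriction of $s$ to $\partial\widetilde f$ then defines a loop in $SO(3)$, whose class in $\pi_1(SO(3))=\mathbb Z_2$ is denoted by $[\widetilde f]$. It is the obstruction to extending $s$ over $\widetilde f$. **Proposition.** For every face $f$ of $X$ and every lift $\widetilde f$ of $f$ in $\widetilde X$, $$[\widetilde f]=c^K(f)\in\mathbb Z_2 .$$ Hence $s(\omega,D,K)$ extends to a framing of $T\widetilde\Sigma\times\mathbb R$ over the whole of $\widetilde X$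 if and only if $K$ is a Kasteleyn orientation on $(X,\omega)$. -/

import Mathlib

noncomputable section

namespace Kasteleyn

/-! ### Cellular decompositions of closed surfaces -/

/-- A cellular decomposition of a closed surface (with at least one edge on each component), given
by its flags.  A flag is a triple (vertex, edge-end at this vertex, side of this edge-end), that
is, one of the triangles of the barycentric subdivision; `r₀`, `r₁`, `r₂` send it to the
neighbouring flag with a different vertex, edge, face respectively.  The 2-cells are the polygons
obtained by following `r₀` and `r₁` alternately, glued along their sides by `r₂`.  Vertices, edges
and faces are the orbits of `⟨r₁, r₂⟩`, `⟨r₀, r₂⟩` (four flags each) and `⟨r₀, r₁⟩`.  Loops,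
multiple edges, vertices of degree one, and faces with one or two sides or meeting both sides of an
edge are allowed, and the surface may be non-orientable. -/
structure CellDecomp (Φ : Type*) where
  r₀ : Φ → Φ
  r₁ : Φ → Φ
  r₂ : Φ → Φ
  invol₀ : ∀ x, r₀ (r₀ x) = x
  invol₁ : ∀ x, r₁ (r₁ x) = x
  invol₂ : ∀ x, r₂ (r₂ x) = x
  free₀ : ∀ x, r₀ x ≠ x
  free₁ : ∀ x, r₁ x ≠ x
  free₂ : ∀ x, r₂ x ≠ x
  comm : ∀ x, r₀ (r₂ x) = r₂ (r₀ x)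
  free₀₂ : ∀ x, r₀ (r₂ x) ≠ x

namespace CellDecomp

variable {Φ : Type*} (X : CellDecomp Φ)

/-- The surface is connected. -/
def Connected : Prop :=
  ∀ x y, Relation.ReflTransGen (fun a b => b = X.r₀ a ∨ b = X.r₁ a ∨ b = X.r₂ a) x y

/-- Two flags have the same vertex. -/
def SameVertex : Φ → Φ → Prop :=
  Relation.ReflTransGen (fun a b => b = X.r₁ a ∨ b = X.r₂ a)

/-- The faces (2-cells). -/
def Face : Type _ := Quot (fun a b : Φ => b = X.r₀ a ∨ b = X.r₁ a)

/-- The face of a flag. -/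
def faceOf (x : Φ) : X.Face := Quot.mk _ x

/-- On an oriented surface, a positive flag is the same as an edge-end, seen as an oriented edge
leaving its vertex with the face of the flag on its left.  `faceNext` is the next oriented edge
along the boundary of that face, run through counterclockwise. -/
def faceNext (x : Φ) : Φ := X.r₁ (X.r₀ x)

/-- The next edge-end at the same vertex, counterclockwise (for a positive flag). -/
def vertNext (x : Φ) : Φ := X.r₂ (X.r₁ x)

/-- The same edge run through backwards, which has the other adjacent face on its left. -/
def rev (x : Φ) : Φ := X.r₂ (X.r₀ x)

/-- The number of sides of the face of a flag. -/
def faceLen (x : Φ) : ℕ := Function.minimalPeriod X.faceNext x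

/-- The degree of the vertex of a flag. -/
def vertDeg (x : Φ) : ℕ := Function.minimalPeriod X.vertNext x

/-- The decomposition `X̃` of the orientation cover.  The flag `(x, a)` lies over `x`, at the point
of the cover whose local orientation makes `x` positive if `a = 0` and negative if `a = 1`;
neighbouring flags have opposite orientation characters. The cover is oriented, and the positive
flags are those with second component `0`. -/
def cover : CellDecomp (Φ × ZMod 2) where
  r₀ y := (X.r₀ y.1, y.2 + 1)
  r₁ y := (X.r₁ y.1, y.2 + 1)
  r₂ y := (X.r₂ y.1, y.2 + 1)
  invol₀ y := Prod.ext (X.invol₀ y.1) (by simp [add_assoc, CharTwo.add_self_eq_zero])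
  invol₁ y := Prod.ext (X.invol₁ y.1) (by simp [add_assoc, CharTwo.add_self_eq_zero])
  invol₂ y := Prod.ext (X.invol₂ y.1) (by simp [add_assoc, CharTwo.add_self_eq_zero])
  free₀ y h := X.free₀ y.1 (congrArg Prod.fst h)
  free₁ y h := X.free₁ y.1 (congrArg Prod.fst h)
  free₂ y h := X.free₂ y.1 (congrArg Prod.fst h)
  comm y := Prod.ext (X.comm y.1) rfl
  free₀₂ y h := X.free₀₂ y.1 (congrArg Prod.fst h)

/-- The covering involution of the orientation cover. -/
def deck (y : Φ × ZMod 2) : Φ × ZMod 2 := (y.1, y.2 + 1)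

/-! ### Orientations of the edges, dimers, the first Stiefel-Whitney class -/

/-- An orientation of the edges: `tail x` says that the edge-end of `x` is the initial one. -/
structure EdgeOrientation where
  tail : Φ → Prop
  tail_r₂ : ∀ x, tail (X.r₂ x) ↔ tail x
  tail_r₀ : ∀ x, tail (X.r₀ x) ↔ ¬ tail x

/-- A dimer configuration: a set of edges (given by their flags) such that every vertex is the
endpoint of exactly one edge-end in the set. -/
structure DimerConfig where
  carrier : Set Φ
  mem_r₀ : ∀ x ∈ carrier, X.r₀ x ∈ carrier
  mem_r₂ : ∀ x ∈ carrier, X.r₂ x ∈ carrier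
  exactly_one : ∀ x, ∃ y ∈ carrier, X.SameVertex x y ∧
    ∀ z ∈ carrier, X.SameVertex x z → z = y ∨ z = X.r₂ y

/-- `ω` is a cellular 1-cochain with values in `ℤ/2`. -/
def IsEdgeCochain (ω : Φ → ZMod 2) : Prop :=
  ∀ x, ω (X.r₀ x) = ω x ∧ ω (X.r₂ x) = ω x

/-- `Transport ω x y s w`: carrying the local orientation defined by `x` along some path of the
1-skeleton from the vertex of `x` to the vertex of `y` gives the local orientation defined by `y`
if `s = 0`, and the opposite one if `s = 1`; the path runs through `w` 1-edges modulo 2. -/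
inductive Transport (ω : Φ → ZMod 2) (x : Φ) : Φ → ZMod 2 → ZMod 2 → Prop
  | start : Transport ω x x 0 0
  | turn₁ {y s w} : Transport ω x y s w → Transport ω x (X.r₁ y) (s + 1) w
  | turn₂ {y s w} : Transport ω x y s w → Transport ω x (X.r₂ y) (s + 1) w
  | edge {y s w} : Transport ω x y s w → Transport ω x (X.r₀ y) (s + 1) (w + ω y)

/-- `ω` represents `w₁`: the local orientation is preserved along a closed path in the 1-skeleton
if and only if the path contains an even number of 1-edges. -/
def RepresentsW1 (ω : Φ → ZMod 2) : Prop :=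
  X.IsEdgeCochain ω ∧ ∀ x s w, X.Transport ω x x s w → (s = 0 ↔ w = 0)

/-- A labelling of the vertices of `X̃` by signs (`0` for `+`, `1` for `-`) determined by `ω`: the
two vertices over a vertex of `X` have opposite labels, and the endpoints of a lift of an edge `e`
have the same label if and only if `ω e = 0`. -/
structure Labelling (ω : Φ → ZMod 2) where
  sign : Φ × ZMod 2 → ZMod 2
  sign_r₁ : ∀ y, sign (X.cover.r₁ y) = sign y
  sign_r₂ : ∀ y, sign (X.cover.r₂ y) = sign y
  sign_deck : ∀ y, sign (deck y) ≠ sign y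
  sign_r₀ : ∀ y, sign (X.cover.r₀ y) = sign y ↔ ω y.1 = 0

variable {X}

/-! ### Kasteleyn curvature -/

open Classical in
/-- The parity of `c^K(f̃) = n^K̃(∂f̃) + #{edges of ∂f̃ joining two vertices labelled -} + 1`, for
the face `f̃` of `X̃` containing the positive flag `y`. The sides of `f̃` are the oriented edges
`y, faceNext y, …`, and a side run through twice counts twice. -/
def liftCurvature {ω : Φ → ZMod 2} (σ : X.Labelling ω) (K : X.EdgeOrientation)
    (y : Φ × ZMod 2) : ZMod 2 :=
  (((Finset.range (X.cover.faceLen y)).filter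
      fun k => ¬ K.tail (X.cover.faceNext^[k] y).1).card : ZMod 2)
  + (((Finset.range (X.cover.faceLen y)).filter
      fun k => σ.sign (X.cover.faceNext^[k] y) = 1 ∧
        σ.sign (X.cover.r₀ (X.cover.faceNext^[k] y)) = 1).card : ZMod 2)
  + 1

/-- The Kasteleyn curvature `c^K(f)`, computed on one lift of the face `f`. -/
def curvature {ω : Φ → ZMod 2} (σ : X.Labelling ω) (K : X.EdgeOrientation) (f : X.Face) :
    ZMod 2 :=
  liftCurvature σ K (Quot.out f, 0)

/-- `K` is a Kasteleyn orientation on `(X, ω)`. -/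
def IsKasteleyn {ω : Φ → ZMod 2} (σ : X.Labelling ω) (K : X.EdgeOrientation) : Prop :=
  ∀ f : X.Face, curvature σ K f = 0

/-! ### The tangent bundle of the orientation cover -/

variable (X)

/-- The angles at which the edges leave the vertices, for some metric on the surface: `angle x` is
the angle of the corner of the face of `x` at the vertex of `x`, and the angles around each vertex
add up to `2π`. -/
structure CornerAngles where
  angle : Φ → ℝ
  pos : ∀ x, 0 < angle x
  angle_r₁ : ∀ x, angle (X.r₁ x) = angle x
  sum_eq : ∀ x, ∑ j ∈ Finset.range (X.vertDeg x), angle (X.vertNext^[j] x) = 2 * Real.pi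

variable {X}

/-- The point at parameter `u ∈ [0, n]` of the boundary of an `n`-gon. The closed polygon is
modelled on the closed unit disc, with its corners at the `n`-th roots of unity. -/
def boundaryPoint (n : ℕ) (u : ℝ) : ℂ := Complex.exp (2 * Real.pi * u / n * Complex.I)

/-- The face of `X̃` containing the positive flag `y` is modelled on the closed unit disc, with the
vertex of `y` at `1` and the oriented edge `faceNext^[k] y` running from the `k`-th to the
`(k+1)`-st root of unity. Its tangent bundle is framed by the constant frame of `ℂ`, and
`sideAngle α y k t` is the argument, in this constant frame, of the forward unit tangent vector of
the `k`-th side at parameter `t ∈ [0, 1]`.  It is the tangent direction `2π(k+t)/n + π/2` of the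
unit circle, bent at both ends so that two consecutive sides meet with the prescribed interior
angle (on the unit circle itself all interior angles are `π`). The planes over the points of two
faces that are identified along an edge are identified by the rotation under which the tangent
vectors of this edge correspond; as the corner angles around each vertex add up to `2π`, this
gives the tangent bundle of the orientation cover. -/
def sideAngle (α : X.CornerAngles) (y : Φ × ZMod 2) (k : ℕ) (t : ℝ) : ℝ :=
  2 * Real.pi * (k + t) / X.cover.faceLen y + Real.pi / 2
  + (1 - t) * ((Real.pi - α.angle (X.cover.faceNext^[k] y).1) / 2)
  - t * ((Real.pi - α.angle (X.cover.faceNext^[k + 1] y).1) / 2)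

end CellDecomp

/-! ### Rotations -/

/-- The group `SO(3)`. A positive orthonormal framing of an oriented 3-dimensional Euclidean space
`(s₁, s₂, s₃)` is the matrix with these columns with respect to a reference framing: a change of
the reference framing acts on the left, while a right-hand rotation of `s` around its own axis
`sᵢ` is the multiplication on the right by the rotation around the `i`-th coordinate axis. -/
abbrev SO3 : Type := Matrix.specialOrthogonalGroup (Fin 3) ℝ

/-- Right-hand rotation around the first axis. -/
def rotX (b : ℝ) : SO3 :=
  ⟨!![1, 0, 0; 0, Real.cos b, -Real.sin b; 0, Real.sin b, Real.cos b], by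
    rw [Matrix.mem_specialOrthogonalGroup_iff, Matrix.mem_orthogonalGroup_iff]
    have h := Real.sin_sq_add_cos_sq b
    constructor
    · ext i j
      fin_cases i <;> fin_cases j <;>
        simp [Matrix.mul_apply, Fin.sum_univ_three] <;> linarith
    · simp [Matrix.det_fin_three]; linarith⟩

/-- Right-hand rotation around the second axis. -/
def rotY (b : ℝ) : SO3 :=
  ⟨!![Real.cos b, 0, Real.sin b; 0, 1, 0; -Real.sin b, 0, Real.cos b], by
    rw [Matrix.mem_specialOrthogonalGroup_iff, Matrix.mem_orthogonalGroup_iff]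
    have h := Real.sin_sq_add_cos_sq b
    constructor
    · ext i j
      fin_cases i <;> fin_cases j <;>
        simp [Matrix.mul_apply, Fin.sum_univ_three] <;> linarith
    · simp [Matrix.det_fin_three]; linarith⟩

/-- Right-hand rotation around the third axis. -/
def rotZ (b : ℝ) : SO3 :=
  ⟨!![Real.cos b, -Real.sin b, 0; Real.sin b, Real.cos b, 0; 0, 0, 1], by
    rw [Matrix.mem_specialOrthogonalGroup_iff, Matrix.mem_orthogonalGroup_iff]
    have h := Real.sin_sq_add_cos_sq b
    constructor
    · ext i j
      fin_cases i <;> fin_cases j <;>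
        simp [Matrix.mul_apply, Fin.sum_univ_three] <;> linarith
    · simp [Matrix.det_fin_three]; linarith⟩

/-- The amount in `[0, 2π)` of right-hand rotation around `s₃` that brings `s₁` from the direction
with polar angle `a` to the one with polar angle `b`, where `s₃` points up if `ε = 0` and down if
`ε = 1` (polar angles are counterclockwise seen from above). -/
def rightTurn (ε : ZMod 2) (a b : ℝ) : ℝ :=
  toIcoMod Real.two_pi_pos 0 (if ε = 0 then b - a else a - b)

/-- The amount in `[0, 2π)` of left-hand rotation around `s₃` that brings `s₁` from `a` to `b`. -/
def leftTurn (ε : ZMod 2) (a b : ℝ) : ℝ := rightTurn ε b a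

/-- The progress at time `t` of the `i`-th of three consecutive moves (`i = 0, 1, 2`), which take
place during `[i/3, (i+1)/3]`. -/
def progress (i : ℕ) (t : ℝ) : ℝ := max 0 (min 1 (3 * t - i))

namespace CellDecomp

variable {Φ : Type*} {X : CellDecomp Φ}

/-! ### The framing `s(ω, D, K)` over the 1-skeleton of the orientation cover

Along an oriented edge `y` of `X̃`, framings of `TΣ̃ × ℝ` are written with respect to the positive
reference framing (forward unit tangent vector of `y`, unit normal vector to its left, `1 ∈ ℝ`). -/

/-- The angle in `[0, 2π)`, counterclockwise, from the edge-end `y` to the dimer at its vertex. -/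
def dimerAngle (α : X.CornerAngles) (D : X.DimerConfig) (y : Φ × ZMod 2) : ℝ :=
  ∑ j ∈ Finset.range (sInf {m : ℕ | (X.cover.vertNext^[m] y).1 ∈ D.carrier}),
    α.angle (X.cover.vertNext^[j] y).1

variable {ω : Φ → ZMod 2}

/-- The framing at the vertex of `y`: `s₁` points along the dimer, `(s₁, s₂)` is positive and
`s₃ = 1` at vertices labelled `+`, `(s₁, s₂)` is negative and `s₃ = -1` at those labelled `-`. -/
def vertexFraming (α : X.CornerAngles) (σ : X.Labelling ω) (D : X.DimerConfig)
    (y : Φ × ZMod 2) : SO3 :=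
  rotZ (dimerAngle α D y) * (if σ.sign y = 0 then 1 else rotX Real.pi)

/-- The framing along an edge of `X̃` run through in the direction of `K̃`.

Along a lift of a 0-edge: a right-hand rotation around `s₃` until `s₁` points in the direction of
the edge; a left-handed half twist around `s₃`, after which `s₁` points backwards; a right-hand
rotation around `s₃` until `s₁` coincides with its value at the final vertex.

Along a lift of a 1-edge: a right-hand rotation around `s₃` until `s₁` points in the direction of
the edge; a right-handed half twist around `s₂`; a left-hand rotation around `s₃` until `s₁`
coincides with its value at the final vertex. -/
def forwardFraming (α : X.CornerAngles) (σ : X.Labelling ω) (D : X.DimerConfig)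
    (y : Φ × ZMod 2) (t : ℝ) : SO3 :=
  let a := dimerAngle α D y
  let b := Real.pi + dimerAngle α D (X.cover.rev y)
  let ε := σ.sign y
  let ε' := σ.sign (X.cover.rev y)
  if ω y.1 = 0 then
    vertexFraming α σ D y
      * rotZ (progress 0 t * rightTurn ε a 0)
      * rotZ (-(progress 1 t * Real.pi))
      * rotZ (progress 2 t * rightTurn ε' Real.pi b)
  else
    vertexFraming α σ D y
      * rotZ (progress 0 t * rightTurn ε a 0)
      * rotY (progress 1 t * Real.pi)
      * rotZ (-(progress 2 t * leftTurn ε' Real.pi b))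

open Classical in
/-- The framing `s(ω, D, K)` along the oriented edge `y` of `X̃`, with respect to the reference
framing of `y`; the reference framing of the reversed edge is obtained from it by a half turn. -/
def edgeFraming (α : X.CornerAngles) (σ : X.Labelling ω) (D : X.DimerConfig)
    (K : X.EdgeOrientation) (y : Φ × ZMod 2) (t : ℝ) : SO3 :=
  if K.tail y.1 then forwardFraming α σ D y t
  else rotZ Real.pi * forwardFraming α σ D (X.cover.rev y) (1 - t)

/-- The restriction of `s(ω, D, K)` to `∂f̃`, with respect to the constant framing of `TΣ̃ × ℝ`
over the face `f̃` containing the positive flag `y`, at the boundary parameter `u ∈ [0, n]`. -/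
def boundaryFraming (α : X.CornerAngles) (σ : X.Labelling ω) (D : X.DimerConfig)
    (K : X.EdgeOrientation) (y : Φ × ZMod 2) (u : ℝ) : SO3 :=
  rotZ (sideAngle α y ⌊u⌋₊ (u - ⌊u⌋₊))
    * edgeFraming α σ D K (X.cover.faceNext^[⌊u⌋₊] y) (u - ⌊u⌋₊)

/-- `γ` is the loop `s(∂f̃)` in `SO(3)`, with respect to the constant framing of `TΣ̃ × ℝ` over
`f̃` that agrees with `s` at the vertex of `y`. -/
def IsBoundaryLoop (α : X.CornerAngles) (σ : X.Labelling ω) (D : X.DimerConfig)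
    (K : X.EdgeOrientation) (y : Φ × ZMod 2) (γ : Path (1 : SO3) 1) : Prop :=
  ∀ t : unitInterval, γ t = (boundaryFraming α σ D K y 0)⁻¹
    * boundaryFraming α σ D K y (X.cover.faceLen y * t)

/-- A (continuous, positive, orthonormal) framing of `TΣ̃ × ℝ` over the whole of `X̃`: for each
positive flag `y` a continuous framing `G y` over the closed face of `y`, written in the constant
framing of its disc.  Two flags of the same face describe the same framing (their discs differ by a
rotation), and the framings over two faces agree along common edges (and vertices). -/
structure IsFraming (α : X.CornerAngles) (G : Φ × ZMod 2 → ℂ → SO3) : Prop where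
  continuousOn : ∀ y, y.2 = 0 → ContinuousOn (G y) (Metric.closedBall 0 1)
  rotate : ∀ y, y.2 = 0 → ∀ z ∈ Metric.closedBall (0 : ℂ) 1,
    G (X.cover.faceNext y) z =
      rotZ (-(2 * Real.pi / X.cover.faceLen y)) * G y (boundaryPoint (X.cover.faceLen y) 1 * z)
  glue : ∀ y, y.2 = 0 → ∀ t ∈ Set.Icc (0 : ℝ) 1,
    rotZ (-sideAngle α y 0 t) * G y (boundaryPoint (X.cover.faceLen y) t) =
      rotZ Real.pi * (rotZ (-sideAngle α (X.cover.rev y) 0 (1 - t))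
        * G (X.cover.rev y) (boundaryPoint (X.cover.faceLen (X.cover.rev y)) (1 - t)))

/-- The framing `s(ω, D, K)` over the 1-skeleton extends to the whole of `X̃`. -/
def FramingExtends (α : X.CornerAngles) (σ : X.Labelling ω) (D : X.DimerConfig)
    (K : X.EdgeOrientation) : Prop :=
  ∃ G : Φ × ZMod 2 → ℂ → SO3, IsFraming α G ∧
    ∀ y, y.2 = 0 → ∀ t ∈ Set.Icc (0 : ℝ) 1,
      rotZ (-sideAngle α y 0 t) * G y (boundaryPoint (X.cover.faceLen y) t)
        = edgeFraming α σ D K y t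

end CellDecomp

end Kasteleyn

end

/-! The unit quaternions are a double cover of `SO3`, and the 3-sphere is simply connected. Hence a
loop in `SO3` is classified by the sign at which its lift starting at 1 ends
(`exists_fundamentalGroup_equiv`), and the theorem becomes a count of the signs picked up by a lift
of the framing around a face.

Fix the lift `vertexQuat` of the framing at each edge-end, and write signs additively in ℤ/2. An
oriented edge with end labels e, e' contributes [it disagrees with K] + [it is not a dimer] + (1 +
e)(1 + e') (`forwardQuat_one`, `edgeQuat_one`). The corner after it contributes 1 + [the next edge
is not a dimer], by comparing the corner angle with the angles to the dimer (`sideQuat_one`).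
Finally the tangent vector makes one full turn around the face, which contributes 1
(`boundaryQuat_faceLen`). Around the face each dimer term occurs twice and cancels; (1 + e)(1 + e')
+ 1 = ee' + e + e', and the terms e + e' add up to 0. What remains is the curvature
(`sum_cornerSign`). In the other lift of the face the sides are reversed and the labels flipped,
which changes each side by e + e', again 0 in total (`liftCurvature_r₀`).

The framing extends over one face exactly when its boundary loop is null-homotopic. The faces can be
filled independently, because the extensions have prescribed boundary values and these already match
along edges (`edgeFraming_rev`). -/

/-! ### Spheres of dimension at least two are simply connected -/

section Sphere

open Metric Module Set

variable {E : Type*} [NormedAddCommGroup E] [InnerProductSpace ℝ E]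

/-- The radial projection of a nonzero vector to the unit sphere. -/
noncomputable def unitVector (v : {v : E // v ≠ 0}) : sphere (0 : E) 1 :=
  ⟨‖v.1‖⁻¹ • v.1, by simp [norm_smul, v.2]⟩

theorem continuous_unitVector : Continuous (unitVector : {v : E // v ≠ 0} → sphere (0 : E) 1) := by
  refine Continuous.subtype_mk (Continuous.smul (Continuous.inv₀ (by fun_prop) ?_) (by fun_prop)) _
  intro v
  simpa using v.2

theorem unitVector_coe (x : sphere (0 : E) 1) (h : (x : E) ≠ 0) : unitVector ⟨(x : E), h⟩ = x := by
  ext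
  simp [unitVector]

/-- A path in the unit sphere is homotopic to the radial projection of any path in the ambient
space at distance less than one from it. -/
theorem Path.exists_homotopic_unitVector {x y : sphere (0 : E) 1} (γ : Path x y)
    (f : C(unitInterval, E)) (h0 : f 0 = x) (h1 : f 1 = y) (hf : ∀ t, ‖f t - γ t‖ < 1) :
    ∃ (hne : ∀ t, f t ≠ 0) (δ : Path x y), (∀ t, δ t = unitVector ⟨f t, hne t⟩) ∧
      Path.Homotopic γ δ := by
  -- The straight-line homotopy from the path to `f` stays at distance less than one from the
  -- sphere, hence misses the origin.
  have key : ∀ p : unitInterval × unitInterval, (γ p.2 : E) + (p.1 : ℝ) • (f p.2 - γ p.2) ≠ 0 := by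
    intro p hp
    have h2 : ‖(γ p.2 : E)‖ = ‖(p.1 : ℝ) • (f p.2 - γ p.2)‖ := by
      simpa using congrArg norm (eq_neg_of_add_eq_zero_left hp)
    rw [norm_smul, norm_eq_of_mem_sphere, Real.norm_of_nonneg p.1.2.1] at h2
    have := hf p.2
    nlinarith [p.1.2.1, p.1.2.2, norm_nonneg (f p.2 - γ p.2)]
  have hne : ∀ t, f t ≠ 0 := fun t => by simpa using key (1, t)
  have hx : ∀ z : sphere (0 : E) 1, (z : E) ≠ 0 := fun z => ne_zero_of_mem_unit_sphere z
  refine ⟨hne, ⟨⟨fun t => unitVector ⟨f t, hne t⟩,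
    continuous_unitVector.comp (by fun_prop)⟩, ?_, ?_⟩, fun t => rfl, ⟨?_⟩⟩
  · simp only [h0]; exact unitVector_coe x (hx x)
  · simp only [h1]; exact unitVector_coe y (hx y)
  · refine ⟨⟨⟨fun p => unitVector ⟨_, key p⟩, continuous_unitVector.comp (by fun_prop)⟩,
      ?_, ?_⟩, ?_⟩
    · intro t
      simpa using unitVector_coe (γ t) (hx _)
    · intro t
      simp
    · rintro s t ht
      simp only [mem_insert_iff, mem_singleton_iff] at ht
      rcases ht with rfl | rfl
      · simpa [h0] using unitVector_coe x (hx x)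
      · simpa [h1] using unitVector_coe y (hx y)

/-- Every path in a sphere of dimension at least two is homotopic to one that is not surjective. -/
theorem Path.exists_homotopic_forall_ne_of_sphere [FiniteDimensional ℝ E] (hE : 2 < finrank ℝ E)
    {x y : sphere (0 : E) 1} (γ : Path x y) :
    ∃ (δ : Path x y) (q : sphere (0 : E) 1), Path.Homotopic γ δ ∧ ∀ t, δ t ≠ q := by
  have huc : UniformContinuous (fun t : ℝ => (γ.extend t : E)) := by
    have h1 : UniformContinuous (fun t : unitInterval => (γ t : E)) :=
      CompactSpace.uniformContinuous_of_continuous (by fun_prop)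
    exact h1.comp (LipschitzWith.projIcc zero_le_one).uniformContinuous
  obtain ⟨g, hg, hgd⟩ := huc.exists_contDiff_dist_le (ε := 1 / 4) (by norm_num)
  -- The affine correction restores the endpoints of the smooth approximation. Each of the three
  -- errors is at most 1/4, so `f` stays at distance less than one from `γ`.
  set f : ℝ → E := fun t => g t + (1 - t) • ((x : E) - g 0) + t • ((y : E) - g 1) with hfdef
  have hfc : ContDiff ℝ 1 f := by
    have : ContDiff ℝ 1 g := hg.of_le (by norm_cast)
    fun_prop
  have hd0 : ‖(x : E) - g 0‖ < 1 / 4 := by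
    have := hgd 0; rw [dist_comm, dist_eq_norm] at this; simpa using this
  have hd1 : ‖(y : E) - g 1‖ < 1 / 4 := by
    have := hgd 1; rw [dist_comm, dist_eq_norm] at this; simpa using this
  have hclose : ∀ t : unitInterval, ‖f t - γ t‖ < 1 := by
    intro t
    have h1 : ‖g t - γ t‖ < 1 / 4 := by
      have := hgd t; rw [dist_eq_norm] at this; simpa using this
    have e : f t - γ t = (g t - γ t) + (1 - (t : ℝ)) • ((x : E) - g 0)
        + (t : ℝ) • ((y : E) - g 1) := by simp only [hfdef]; abel
    have h2 : ‖(1 - (t : ℝ)) • ((x : E) - g 0)‖ ≤ 1 / 4 := by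
      rw [norm_smul, Real.norm_of_nonneg (by linarith [t.2.2])]
      nlinarith [t.2.1, t.2.2, norm_nonneg ((x : E) - g 0)]
    have h3 : ‖(t : ℝ) • ((y : E) - g 1)‖ ≤ 1 / 4 := by
      rw [norm_smul, Real.norm_of_nonneg t.2.1]
      nlinarith [t.2.1, t.2.2, norm_nonneg ((y : E) - g 1)]
    rw [e]
    linarith [norm_add₃_le (a := g t - γ t) (b := (1 - (t : ℝ)) • ((x : E) - g 0))
      (c := (t : ℝ) • ((y : E) - g 1))]
  obtain ⟨hne, δ, hδ, hγδ⟩ := γ.exists_homotopic_unitVector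
    ⟨fun t => f t, hfc.continuous.comp continuous_subtype_val⟩ (by simp [hfdef]) (by simp [hfdef])
    hclose
  -- The cone over a C¹ curve is a C¹ image of the plane, so it cannot fill a space of dimension at
  -- least three; a vector outside it gives a direction that the projected curve misses.
  have hcone : ContDiff ℝ 1 (fun p : ℝ × ℝ => p.1 • f p.2) := by fun_prop
  have hdense := hcone.dense_compl_range_of_finrank_lt_finrank (by simpa using hE)
  obtain ⟨q, hq⟩ := hdense.nonempty
  have hq0 : q ≠ 0 := fun h => hq ⟨(0, 0), by simp [h]⟩
  refine ⟨δ, unitVector ⟨q, hq0⟩, hγδ, fun t ht => hq ⟨(‖q‖ * ‖f t‖⁻¹, t), ?_⟩⟩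
  rw [hδ t] at ht
  have := congrArg (fun z : sphere (0 : E) 1 => ‖q‖ • (z : E)) ht
  simpa [unitVector, smul_smul, hq0] using this

/-- The unit sphere of a space of dimension at least three is simply connected. -/
theorem simplyConnectedSpace_sphere [FiniteDimensional ℝ E] (hE : 2 < finrank ℝ E) :
    SimplyConnectedSpace (sphere (0 : E) 1) := by
  rw [simply_connected_iff_loops_nullhomotopic]
  refine ⟨isPathConnected_iff_pathConnectedSpace.mp (isPathConnected_sphere
    (Module.lt_rank_of_lt_finrank (by exact_mod_cast (by omega : 1 < finrank ℝ E))) _ zero_le_one),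
    fun x γ => ?_⟩
  obtain ⟨δ, q, hγδ, hq⟩ := γ.exists_homotopic_forall_ne_of_sphere hE
  refine hγδ.trans ?_
  -- Stereographic projection from the missed point moves the loop into a vector space, where it
  -- contracts; the contraction is carried back by the inverse chart.
  let e := stereographic (norm_eq_of_mem_sphere q)
  have hx : x ≠ q := by simpa using hq 0
  let η : Path (e x) (e x) :=
    { toFun := fun t => e (δ t)
      continuous_toFun := e.continuousOn.comp_continuous δ.continuous (fun t => hq t)
      source' := by simp
      target' := by simp }
  have h1 : Path.Homotopic η (Path.refl _) := SimplyConnectedSpace.paths_homotopic _ _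
  have hc : Continuous e.symm := by
    rw [← continuousOn_univ]
    exact e.continuousOn_symm
  have h2 := h1.map ⟨e.symm, hc⟩
  have hsx : e.symm (e x) = x := e.left_inv hx
  have h3 := h2.pathCast hsx.symm hsx.symm
  convert h3 using 1
  · ext t
    have : e.symm (e (δ t)) = δ t := e.left_inv (hq t)
    simp [η, this]
  · ext t
    simp [hsx]

end Sphere

/-! ### The double cover of `SO(3)` by the unit quaternions -/

noncomputable section

namespace Kasteleyn

attribute [local simp] Quaternion.re_one Quaternion.imI_one Quaternion.imJ_one Quaternion.imK_one

/-- The group of unit quaternions. -/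
abbrev UnitQuaternion : Type := Metric.sphere (0 : Quaternion ℝ) 1

instance UnitQuaternion.instGroup : Group UnitQuaternion := Metric.unitSphere.instGroup

instance UnitQuaternion.instMul : Mul UnitQuaternion := UnitQuaternion.instGroup.toMul

instance UnitQuaternion.instHasDistribNeg : HasDistribNeg UnitQuaternion :=
  Metric.sphere.instHasDistribNeg

theorem UnitQuaternion.ext_coords {p q : UnitQuaternion} (h0 : p.1.re = q.1.re)
    (hI : p.1.imI = q.1.imI) (hJ : p.1.imJ = q.1.imJ) (hK : p.1.imK = q.1.imK) : p = q :=
  Subtype.ext (Quaternion.ext _ _ h0 hI hJ hK)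

/-- The matrix of `v ↦ q v q̄` on the imaginary quaternions. -/
def conjMatrix (q : Quaternion ℝ) : Matrix (Fin 3) (Fin 3) ℝ :=
  !![q.re ^ 2 + q.imI ^ 2 - q.imJ ^ 2 - q.imK ^ 2, 2 * (q.imI * q.imJ - q.re * q.imK),
      2 * (q.imI * q.imK + q.re * q.imJ);
    2 * (q.imI * q.imJ + q.re * q.imK), q.re ^ 2 - q.imI ^ 2 + q.imJ ^ 2 - q.imK ^ 2,
      2 * (q.imJ * q.imK - q.re * q.imI);
    2 * (q.imI * q.imK - q.re * q.imJ), 2 * (q.imJ * q.imK + q.re * q.imI),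
      q.re ^ 2 - q.imI ^ 2 - q.imJ ^ 2 + q.imK ^ 2]

theorem conjMatrix_mul (p q : Quaternion ℝ) :
    conjMatrix (p * q) = conjMatrix p * conjMatrix q := by
  ext i j
  fin_cases i <;> fin_cases j <;>
    simp [conjMatrix, Matrix.mul_apply, Fin.sum_univ_three] <;> ring

theorem conjMatrix_one : conjMatrix 1 = 1 := by
  ext i j
  fin_cases i <;> fin_cases j <;> simp [conjMatrix]

theorem conjMatrix_star (q : Quaternion ℝ) : conjMatrix (star q) = star (conjMatrix q) := by
  ext i j
  fin_cases i <;> fin_cases j <;> simp [conjMatrix, Matrix.star_apply] <;> ring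

theorem det_conjMatrix (q : Quaternion ℝ) :
    (conjMatrix q).det = (q.re ^ 2 + q.imI ^ 2 + q.imJ ^ 2 + q.imK ^ 2) ^ 3 := by
  simp [conjMatrix, Matrix.det_fin_three]
  ring

theorem UnitQuaternion.normSq_eq_one (q : UnitQuaternion) :
    Quaternion.normSq (q : Quaternion ℝ) = 1 := by
  rw [Quaternion.normSq_eq_norm_mul_self, norm_eq_of_mem_sphere, one_mul]

theorem UnitQuaternion.sum_sq (q : UnitQuaternion) :
    q.1.re ^ 2 + q.1.imI ^ 2 + q.1.imJ ^ 2 + q.1.imK ^ 2 = 1 := by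
  rw [← Quaternion.normSq_def', UnitQuaternion.normSq_eq_one]

/-- The double cover of `SO(3)` by the unit quaternions. -/
def spinCover : UnitQuaternion →* SO3 where
  toFun q := ⟨conjMatrix q, by
    rw [Matrix.mem_specialOrthogonalGroup_iff, Matrix.mem_orthogonalGroup_iff]
    constructor
    · change conjMatrix q * star (conjMatrix q) = 1
      rw [← conjMatrix_star, ← conjMatrix_mul,
        Quaternion.self_mul_star, UnitQuaternion.normSq_eq_one, Quaternion.coe_one, conjMatrix_one]
    · rw [det_conjMatrix, UnitQuaternion.sum_sq, one_pow]⟩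
  map_one' := Subtype.ext conjMatrix_one
  map_mul' p q := Subtype.ext (conjMatrix_mul p q)

theorem continuous_spinCover : Continuous spinCover := by
  refine Continuous.subtype_mk (continuous_matrix fun i j => ?_) _
  have h0 : Continuous fun q : UnitQuaternion => q.1.re :=
    Quaternion.continuous_re.comp continuous_subtype_val
  have hI : Continuous fun q : UnitQuaternion => q.1.imI :=
    Quaternion.continuous_imI.comp continuous_subtype_val
  have hJ : Continuous fun q : UnitQuaternion => q.1.imJ :=
    Quaternion.continuous_imJ.comp continuous_subtype_val
  have hK : Continuous fun q : UnitQuaternion => q.1.imK :=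
    Quaternion.continuous_imK.comp continuous_subtype_val
  fin_cases i <;> fin_cases j <;> simp only [conjMatrix] <;> simp <;> fun_prop

theorem spinCover_neg (q : UnitQuaternion) : spinCover (-q) = spinCover q := by
  apply Subtype.ext
  change conjMatrix (-q.1) = conjMatrix q.1
  ext i j
  fin_cases i <;> fin_cases j <;> simp [conjMatrix]

/-- A quaternion from its coordinates. -/
def quatOfCoords (a b c d : ℝ) : Quaternion ℝ := ⟨a, b, c, d⟩

@[simp]
theorem re_quatOfCoords (a b c d : ℝ) : (quatOfCoords a b c d).re = a := rfl

@[simp]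
theorem imI_quatOfCoords (a b c d : ℝ) : (quatOfCoords a b c d).imI = b := rfl

@[simp]
theorem imJ_quatOfCoords (a b c d : ℝ) : (quatOfCoords a b c d).imJ = c := rfl

@[simp]
theorem imK_quatOfCoords (a b c d : ℝ) : (quatOfCoords a b c d).imK = d := rfl

/-- A unit quaternion from its coordinates. -/
def unitQuaternion (a b c d : ℝ) (h : a ^ 2 + b ^ 2 + c ^ 2 + d ^ 2 = 1) : UnitQuaternion :=
  ⟨quatOfCoords a b c d, by
    rw [mem_sphere_zero_iff_norm, ← sq_eq_sq₀ (norm_nonneg _) zero_le_one, sq,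
      ← Quaternion.normSq_eq_norm_mul_self, Quaternion.normSq_def', one_pow]
    exact h⟩

/-- The lift of `rotX`. -/
def quatX (b : ℝ) : UnitQuaternion :=
  unitQuaternion (Real.cos (b / 2)) (Real.sin (b / 2)) 0 0 (by simp)

/-- The lift of `rotY`. -/
def quatY (b : ℝ) : UnitQuaternion :=
  unitQuaternion (Real.cos (b / 2)) 0 (Real.sin (b / 2)) 0 (by simp)

/-- The lift of `rotZ`. -/
def quatZ (b : ℝ) : UnitQuaternion :=
  unitQuaternion (Real.cos (b / 2)) 0 0 (Real.sin (b / 2)) (by simp)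

theorem cos_eq_half (b : ℝ) : Real.cos b = Real.cos (b / 2) ^ 2 - Real.sin (b / 2) ^ 2 := by
  rw [← Real.cos_two_mul']; ring_nf

theorem sin_eq_half (b : ℝ) : Real.sin b = 2 * (Real.cos (b / 2) * Real.sin (b / 2)) := by
  have := Real.sin_two_mul (b / 2)
  rw [show 2 * (b / 2) = b by ring] at this
  rw [this]; ring

theorem spinCover_quatX (b : ℝ) : spinCover (quatX b) = rotX b := by
  apply Subtype.ext
  ext i j
  fin_cases i <;> fin_cases j <;>
    simp [spinCover, conjMatrix, quatX, unitQuaternion, rotX, cos_eq_half b, sin_eq_half b]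

theorem spinCover_quatY (b : ℝ) : spinCover (quatY b) = rotY b := by
  apply Subtype.ext
  ext i j
  fin_cases i <;> fin_cases j <;>
    simp [spinCover, conjMatrix, quatY, unitQuaternion, rotY, cos_eq_half b, sin_eq_half b]

theorem spinCover_quatZ (b : ℝ) : spinCover (quatZ b) = rotZ b := by
  apply Subtype.ext
  ext i j
  fin_cases i <;> fin_cases j <;>
    simp [spinCover, conjMatrix, quatZ, unitQuaternion, rotZ, cos_eq_half b, sin_eq_half b]

theorem quatZ_add (a b : ℝ) : quatZ (a + b) = quatZ a * quatZ b := by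
  apply UnitQuaternion.ext_coords <;>
    simp [quatZ, unitQuaternion, add_div, Real.cos_add, Real.sin_add]
  ring

theorem quatZ_zero : quatZ 0 = 1 := by
  apply UnitQuaternion.ext_coords <;>
    simp [quatZ, unitQuaternion]

theorem quatZ_two_pi : quatZ (2 * Real.pi) = -1 := by
  apply UnitQuaternion.ext_coords <;>
    simp [quatZ, unitQuaternion]

theorem quatZ_neg_two_pi : quatZ (-(2 * Real.pi)) = -1 := by
  apply UnitQuaternion.ext_coords <;>
    simp [quatZ, unitQuaternion, neg_div]

/-- A half turn around the first axis reverses the rotations around the third one. -/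
theorem quatX_pi_mul_quatZ (b : ℝ) : quatX Real.pi * quatZ b = quatZ (-b) * quatX Real.pi := by
  apply UnitQuaternion.ext_coords <;>
    simp [quatZ, quatX, unitQuaternion, neg_div]

/-- A half turn around the second axis reverses the rotations around the third one. -/
theorem quatY_pi_mul_quatZ (b : ℝ) : quatY Real.pi * quatZ b = quatZ (-b) * quatY Real.pi := by
  apply UnitQuaternion.ext_coords <;>
    simp [quatZ, quatY, unitQuaternion, neg_div]

theorem quatZ_pi_mul_quatX_pi : quatZ Real.pi * quatX Real.pi = quatY Real.pi := by
  apply UnitQuaternion.ext_coords <;>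
    simp [quatZ, quatX, quatY, unitQuaternion]

theorem quatX_pi_mul_quatY_pi : quatX Real.pi * quatY Real.pi = quatZ Real.pi := by
  apply UnitQuaternion.ext_coords <;>
    simp [quatZ, quatX, quatY, unitQuaternion]

theorem continuous_unitQuaternion {T : Type*} [TopologicalSpace T] {a b c d : T → ℝ}
    (ha : Continuous a) (hb : Continuous b) (hc : Continuous c) (hd : Continuous d)
    (h : ∀ t, a t ^ 2 + b t ^ 2 + c t ^ 2 + d t ^ 2 = 1) :
    Continuous fun t => unitQuaternion (a t) (b t) (c t) (d t) (h t) := by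
  refine Continuous.subtype_mk ?_ _
  have e : ∀ t, quatOfCoords (a t) (b t) (c t) (d t) =
      Quaternion.linearIsometryEquivTuple.symm (WithLp.toLp 2 ![a t, b t, c t, d t]) := fun t => rfl
  simp only [e]
  refine Quaternion.linearIsometryEquivTuple.symm.continuous.comp
    ((PiLp.continuous_toLp 2 _).comp (continuous_pi fun i => ?_))
  fin_cases i <;> assumption

@[fun_prop]
theorem continuous_quatY : Continuous quatY :=
  continuous_unitQuaternion (by fun_prop) (by fun_prop) (by fun_prop) (by fun_prop) _

@[fun_prop]
theorem continuous_quatZ : Continuous quatZ :=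
  continuous_unitQuaternion (by fun_prop) (by fun_prop) (by fun_prop) (by fun_prop) _

/-! ### Kernel, surjectivity and covering property of the spin cover -/

theorem spinCover_eq_one_iff (q : UnitQuaternion) : spinCover q = 1 ↔ q = 1 ∨ q = -1 := by
  constructor
  · intro h
    have h' : conjMatrix q = 1 := congrArg Subtype.val h
    have hs := q.sum_sq
    have h00 := congrFun (congrFun h' 0) 0
    have h11 := congrFun (congrFun h' 1) 1
    have h22 := congrFun (congrFun h' 2) 2
    simp [conjMatrix] at h00 h11 h22
    have hI : q.1.imI = 0 := by nlinarith
    have hJ : q.1.imJ = 0 := by nlinarith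
    have hK : q.1.imK = 0 := by nlinarith
    have hre : q.1.re = 1 ∨ q.1.re = -1 := by
      rw [← sq_eq_one_iff]
      nlinarith
    rcases hre with hre | hre
    · left
      apply UnitQuaternion.ext_coords <;> simp [*]
    · right
      apply UnitQuaternion.ext_coords <;> simp [*]
  · rintro (rfl | rfl)
    · exact map_one _
    · rw [spinCover_neg, map_one]

/-- A rotation that fixes the third axis is `rotZ`. -/
theorem exists_eq_rotZ (N : SO3) (h02 : N.1 0 2 = 0) (h12 : N.1 1 2 = 0) (h22 : N.1 2 2 = 1) :
    ∃ b, N = rotZ b := by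
  obtain ⟨hO, hdet⟩ := Matrix.mem_specialOrthogonalGroup_iff.mp N.2
  have hrow := (Matrix.mem_orthogonalGroup_iff _ _).mp hO
  have hcol := (Matrix.mem_orthogonalGroup_iff' _ _).mp hO
  have r22 := congrFun (congrFun hrow 2) 2
  have c00 := congrFun (congrFun hcol 0) 0
  have c01 := congrFun (congrFun hcol 0) 1
  simp [Matrix.mul_apply, Fin.sum_univ_three] at r22 c00 c01
  have h20 : N.1 2 0 = 0 := by nlinarith
  have h21 : N.1 2 1 = 0 := by nlinarith
  rw [Matrix.det_fin_three] at hdet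
  simp only [h02, h12, h22, h20, h21] at hdet c00 c01
  have hsq : N.1 0 0 ^ 2 + N.1 1 0 ^ 2 = 1 := by nlinarith
  -- Determinant one and orthogonality of the first two columns form a linear system for the second
  -- column; its solution is the first column turned by a right angle.
  have h11 : N.1 1 1 = N.1 0 0 := by
    linear_combination (N.1 0 0) * hdet + N.1 1 0 * c01 - N.1 1 1 * hsq
  have h01 : N.1 0 1 = -N.1 1 0 := by
    linear_combination -(N.1 1 0) * hdet + N.1 0 0 * c01 - N.1 0 1 * hsq
  have hn : ‖(⟨N.1 0 0, N.1 1 0⟩ : ℂ)‖ = 1 := by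
    rw [Complex.norm_eq_sqrt_sq_add_sq, hsq, Real.sqrt_one]
  have hc := Complex.norm_mul_cos_arg ⟨N.1 0 0, N.1 1 0⟩
  have hs := Complex.norm_mul_sin_arg ⟨N.1 0 0, N.1 1 0⟩
  rw [hn, one_mul] at hc hs
  refine ⟨Complex.arg ⟨N.1 0 0, N.1 1 0⟩, Subtype.ext ?_⟩
  ext i j
  fin_cases i <;> fin_cases j <;> simp [rotZ, *]

/-- Polar coordinates twice: for x + iy, of modulus r, and then for z + ir, of modulus one. -/
theorem exists_spherical (x y z : ℝ) (h : x ^ 2 + y ^ 2 + z ^ 2 = 1) :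
    ∃ φ θ, x = Real.cos φ * Real.sin θ ∧ y = Real.sin φ * Real.sin θ ∧ z = Real.cos θ := by
  set r := ‖(⟨x, y⟩ : ℂ)‖ with hr
  have hr2 : r ^ 2 = x ^ 2 + y ^ 2 := by
    rw [hr, Complex.norm_eq_sqrt_sq_add_sq, Real.sq_sqrt (by positivity)]
  have hn : ‖(⟨z, r⟩ : ℂ)‖ = 1 := by
    rw [Complex.norm_eq_sqrt_sq_add_sq, hr2]
    simp only
    rw [show z ^ 2 + (x ^ 2 + y ^ 2) = 1 by linarith, Real.sqrt_one]
  have hc := Complex.norm_mul_cos_arg ⟨z, r⟩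
  have hs := Complex.norm_mul_sin_arg ⟨z, r⟩
  rw [hn, one_mul] at hc hs
  have hc' := Complex.norm_mul_cos_arg ⟨x, y⟩
  have hs' := Complex.norm_mul_sin_arg ⟨x, y⟩
  refine ⟨Complex.arg ⟨x, y⟩, Complex.arg ⟨z, r⟩, ?_, ?_, ?_⟩
  · rw [hs, mul_comm]; exact hc'.symm
  · rw [hs, mul_comm]; exact hs'.symm
  · exact hc.symm

/-- Euler angles: after the spherical coordinates of the third column are undone, the matrix fixes
the third axis and is some `rotZ ψ`. Each of the three factors has an explicit lift. -/
theorem spinCover_surjective : Function.Surjective spinCover := by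
  intro M
  obtain ⟨hO, -⟩ := Matrix.mem_specialOrthogonalGroup_iff.mp M.2
  have c22 := congrFun (congrFun ((Matrix.mem_orthogonalGroup_iff' _ _).mp hO) 2) 2
  simp [Matrix.mul_apply, Fin.sum_univ_three] at c22
  obtain ⟨φ, θ, hx, hy, hz⟩ := exists_spherical (M.1 0 2) (M.1 1 2) (M.1 2 2) (by nlinarith)
  have hφ := Real.sin_sq_add_cos_sq φ
  have hθ := Real.sin_sq_add_cos_sq θ
  have hval : ∀ i, ((rotY (-θ) * rotZ (-φ) * M).1 : Matrix _ _ ℝ) i 2 =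
      ((rotY (-θ)).1 * (rotZ (-φ)).1 * M.1) i 2 := fun i => rfl
  obtain ⟨ψ, hψ⟩ := exists_eq_rotZ (rotY (-θ) * rotZ (-φ) * M)
    (by
      rw [hval]
      simp [Matrix.mul_apply, Fin.sum_univ_three, rotY, rotZ, hx, hy, hz]
      linear_combination Real.cos θ * Real.sin θ * hφ)
    (by
      rw [hval]
      simp [Matrix.mul_apply, Fin.sum_univ_three, rotY, rotZ, hx, hy, hz]
      ring)
    (by
      rw [hval]
      simp [Matrix.mul_apply, Fin.sum_univ_three, rotY, rotZ, hx, hy, hz]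
      linear_combination Real.sin θ ^ 2 * hφ + hθ)
  refine ⟨(quatY (-θ) * quatZ (-φ))⁻¹ * quatZ ψ, ?_⟩
  rw [map_mul, map_inv, map_mul, spinCover_quatY, spinCover_quatZ, spinCover_quatZ, ← hψ]
  group

/-- The 3-sphere is compact and `SO3` is Hausdorff, so the map is closed. -/
theorem isQuotientMap_spinCover : Topology.IsQuotientMap spinCover :=
  continuous_spinCover.isClosedMap.isQuotientMap continuous_spinCover spinCover_surjective

theorem coe_ker_spinCover : (spinCover.ker : Set UnitQuaternion) = {1, -1} := by
  ext q
  simp [MonoidHom.mem_ker, spinCover_eq_one_iff]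

theorem isQuotientCoveringMap_spinCover :
    IsQuotientCoveringMap spinCover spinCover.ker := by
  refine isQuotientMap_spinCover.isQuotientCoveringMap_of_isDiscrete_ker_monoidHom ?_
  rw [coe_ker_spinCover]
  exact (Set.toFinite _).isDiscrete

/-! ### The fundamental group of SO(3) -/

theorem neg_one_ne_one_unitQuaternion : (-1 : UnitQuaternion) ≠ 1 := by
  intro h
  have := congrArg (fun q : UnitQuaternion => q.1.re) h
  simp at this
  linarith

/-- The element `(-1)^c` of the kernel of the double cover. -/
def signQuat (c : ZMod 2) : UnitQuaternion := if c = 0 then 1 else -1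

theorem signQuat_add (a b : ZMod 2) : signQuat (a + b) = signQuat a * signQuat b := by
  have h : ∀ a b : ZMod 2, (a = 0 ∧ b = 0 ∧ a + b = 0) ∨ (a = 0 ∧ b ≠ 0 ∧ a + b ≠ 0) ∨
      (a ≠ 0 ∧ b = 0 ∧ a + b ≠ 0) ∨ (a ≠ 0 ∧ b ≠ 0 ∧ a + b = 0) := by decide
  simp only [signQuat]
  rcases h a b with ⟨h1, h2, h3⟩ | ⟨h1, h2, h3⟩ | ⟨h1, h2, h3⟩ | ⟨h1, h2, h3⟩ <;>
    simp only [h3, if_true, if_false] <;>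
    simp only [h1, h2, if_true, if_false, one_mul, mul_one, neg_mul, neg_neg]

theorem spinCover_signQuat (c : ZMod 2) : spinCover (signQuat c) = 1 := by
  rw [spinCover_eq_one_iff, signQuat]
  split_ifs <;> simp

theorem signQuat_comm (c : ZMod 2) (q : UnitQuaternion) : q * signQuat c = signQuat c * q := by
  rw [signQuat]
  split_ifs <;> simp

/-- For a quotient of a simply connected group by a discrete kernel, the fundamental group is the
kernel, up to passing to the opposite group. The second half makes the class of a loop computable
from any explicit lift. -/
theorem exists_fundamentalGroup_equiv :
    ∃ cls : FundamentalGroup SO3 1 ≃* Multiplicative (ZMod 2),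
      ∀ (Γ : C(unitInterval, UnitQuaternion)) (γ : Path (1 : SO3) 1) (c : ZMod 2), Γ 0 = 1 →
        (∀ t, spinCover (Γ t) = γ t) → Γ 1 = signQuat c →
        cls (FundamentalGroup.fromPath (Path.Homotopic.Quotient.mk γ)) =
          Multiplicative.ofAdd c := by
  have hsc : SimplyConnectedSpace UnitQuaternion :=
    simplyConnectedSpace_sphere (by rw [Quaternion.finrank_eq_four]; norm_num)
  have hp := isQuotientCoveringMap_spinCover
  let e : spinCover ⁻¹' {1} := ⟨1, map_one _⟩
  have hcard : Nat.card (spinCover.ker)ᵐᵒᵖ = 2 := by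
    rw [Nat.card_congr MulOpposite.opEquiv.symm]
    have : Nat.card (spinCover.ker : Set UnitQuaternion) = 2 := by
      rw [coe_ker_spinCover, Nat.card_coe_set_eq,
        Set.ncard_pair neg_one_ne_one_unitQuaternion.symm]
    exact this
  let ι : (spinCover.ker)ᵐᵒᵖ ≃* Multiplicative (ZMod 2) :=
    mulEquivOfPrimeCardEq (p := 2) hcard (by simp)
  refine ⟨(hp.fundamentalGroupEquiv e).trans ι, fun Γ γ c h0 hΓ h1 => ?_⟩
  have hone : ∀ g : (spinCover.ker)ᵐᵒᵖ, (g.unop : UnitQuaternion) = signQuat c →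
      ι g = Multiplicative.ofAdd c := by
    intro g hg
    by_cases hc : c = 0
    · have : g = 1 := by
        apply MulOpposite.unop_injective
        apply Subtype.ext
        simp [hg, hc, signQuat]
      rw [this, map_one, hc, ofAdd_zero]
    · have hne : ι g ≠ 1 := by
        rw [Ne, MulEquiv.map_eq_one_iff]
        rintro rfl
        simp only [signQuat, hc, if_false] at hg
        exact neg_one_ne_one_unitQuaternion hg.symm
      have h2 : ∀ (z : Multiplicative (ZMod 2)) (c : ZMod 2), z ≠ 1 → c ≠ 0 →
        z = Multiplicative.ofAdd c := by decide
      exact h2 _ _ hne hc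
  apply hone
  let e' : spinCover ⁻¹' {1} := ⟨signQuat c, spinCover_signQuat c⟩
  let G : Path (e : UnitQuaternion) (e' : UnitQuaternion) := ⟨Γ, h0, h1⟩
  have hm : hp.isCoveringMap.monodromy (Path.Homotopic.Quotient.mk γ) e = e' := by
    apply hp.isCoveringMap.monodromy_eq_of_map_eq (Path.Homotopic.Quotient.mk G)
    refine congr_arg Path.Homotopic.Quotient.mk ?_
    ext1
    funext t
    exact hΓ t
  -- The kernel element attached to `γ` carries 1 to the endpoint of the lift. As it acts by
  -- multiplication, it equals that endpoint.
  have h3 := hp.unop_fundamentalGroupToMulOpposite_smul (e := e)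
    (γ := FundamentalGroup.fromPath (Path.Homotopic.Quotient.mk γ))
  change ((hp.fundamentalGroupToMulOpposite e _).unop : UnitQuaternion) * 1 = _ at h3
  rw [mul_one] at h3
  exact h3.trans (congrArg Subtype.val hm)

end Kasteleyn

end

/-! ### Combinatorics of flags -/

noncomputable section

namespace Kasteleyn

/-- Cyclic shift of a sum around a face, the source of the cancellations below. -/
theorem sum_range_succ_eq_of_periodic {M : Type*} [AddCommMonoid M] (f : ℕ → M) (n : ℕ)
    (h : f n = f 0) : ∑ k ∈ Finset.range n, f (k + 1) = ∑ k ∈ Finset.range n, f k := by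
  cases n with
  | zero => rfl
  | succ n => rw [Finset.sum_range_succ, h, Finset.sum_range_succ']

namespace CellDecomp

variable {Φ : Type*} (X : CellDecomp Φ)

-- Words of even length in the flag involutions keep the orientation character, so turning around
-- faces and vertices of the cover is computed in `X`.
@[simp]
theorem cover_faceNext (y : Φ × ZMod 2) : X.cover.faceNext y = (X.faceNext y.1, y.2) := by
  simp [faceNext, cover, add_assoc, CharTwo.add_self_eq_zero]

@[simp]
theorem cover_vertNext (y : Φ × ZMod 2) : X.cover.vertNext y = (X.vertNext y.1, y.2) := by
  simp [vertNext, cover, add_assoc, CharTwo.add_self_eq_zero]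

@[simp]
theorem cover_rev (y : Φ × ZMod 2) : X.cover.rev y = (X.rev y.1, y.2) := by
  simp [rev, cover, add_assoc, CharTwo.add_self_eq_zero]

@[simp]
theorem cover_faceNext_iterate (k : ℕ) (y : Φ × ZMod 2) :
    X.cover.faceNext^[k] y = (X.faceNext^[k] y.1, y.2) := by
  induction k generalizing y with
  | zero => rfl
  | succ k ih => rw [Function.iterate_succ_apply, ih, cover_faceNext, Function.iterate_succ_apply]

@[simp]
theorem cover_vertNext_iterate (k : ℕ) (y : Φ × ZMod 2) :
    X.cover.vertNext^[k] y = (X.vertNext^[k] y.1, y.2) := by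
  induction k generalizing y with
  | zero => rfl
  | succ k ih => rw [Function.iterate_succ_apply, ih, cover_vertNext, Function.iterate_succ_apply]

@[simp]
theorem cover_faceLen (y : Φ × ZMod 2) : X.cover.faceLen y = X.faceLen y.1 := by
  refine Function.minimalPeriod_eq_minimalPeriod_iff.mpr fun n => ?_
  simp only [Function.IsPeriodicPt, Function.IsFixedPt, cover_faceNext_iterate]
  exact ⟨fun h => congrArg Prod.fst h, fun h => Prod.ext h rfl⟩

@[simp]
theorem rev_rev (x : Φ) : X.rev (X.rev x) = x := by
  simp [rev, X.comm, X.invol₀, X.invol₂]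

theorem vertNext_faceNext (x : Φ) : X.vertNext (X.faceNext x) = X.rev x := by
  simp [vertNext, faceNext, rev, X.invol₁]

theorem faceNext_injective : Function.Injective X.faceNext := by
  intro x y h
  have := congrArg (fun z => X.r₀ (X.r₁ z)) h
  simpa [faceNext, X.invol₁, X.invol₀] using this

theorem vertNext_injective : Function.Injective X.vertNext := by
  intro x y h
  have := congrArg (fun z => X.r₁ (X.r₂ z)) h
  simpa [vertNext, X.invol₁, X.invol₂] using this

@[simp]
theorem faceNext_iterate_faceLen (x : Φ) : X.faceNext^[X.faceLen x] x = x :=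
  Function.iterate_minimalPeriod

theorem faceLen_pos [Finite Φ] (x : Φ) : 0 < X.faceLen x :=
  Function.minimalPeriod_pos_of_mem_periodicPts (X.faceNext_injective.mem_periodicPts x)

theorem vertDeg_pos [Finite Φ] (x : Φ) : 0 < X.vertDeg x :=
  Function.minimalPeriod_pos_of_mem_periodicPts (X.vertNext_injective.mem_periodicPts x)

theorem faceLen_faceNext [Finite Φ] (x : Φ) : X.faceLen (X.faceNext x) = X.faceLen x :=
  Function.minimalPeriod_apply (X.faceNext_injective.mem_periodicPts x)

/-- Going around a vertex never ends on the other side of the initial edge-end. -/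
theorem vertNext_iterate_ne (j : ℕ) (x : Φ) : X.vertNext^[j] x ≠ X.r₂ x := by
  induction j using Nat.strong_induction_on generalizing x with
  | _ j ih =>
    -- Applying `r₁ ∘ r₂` to the equation turns it into the same equation for `vertNext x` with two
    -- steps fewer, so it reduces to a fixed point of `r₂` or of `r₁`.
    match j with
    | 0 => exact fun h => X.free₂ x h.symm
    | 1 =>
      intro h
      have := congrArg X.r₂ h
      simp only [Function.iterate_one, vertNext, X.invol₂] at this
      exact X.free₁ x this
    | j + 2 =>
      intro h
      refine ih j (by omega) (X.vertNext x) ?_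
      rw [show j + 2 = (j + 1) + 1 from rfl, Function.iterate_succ_apply',
        Function.iterate_succ_apply] at h
      have := congrArg (fun z => X.r₁ (X.r₂ z)) h
      simpa [vertNext, X.invol₁, X.invol₂] using this

/-- The flags at a vertex are obtained by going around it. -/
theorem exists_vertNext_iterate_of_sameVertex [Finite Φ] {x z : Φ} (h : X.SameVertex x z) :
    ∃ m, z = X.vertNext^[m] x ∨ z = X.r₂ (X.vertNext^[m] x) := by
  induction h with
  | refl => exact ⟨0, Or.inl rfl⟩
  | @tail b c _ hbc ih =>
    obtain ⟨m, hm⟩ := ih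
    rcases hm with rfl | rfl
    · rcases hbc with rfl | rfl
      · refine ⟨m + 1, Or.inr ?_⟩
        rw [Function.iterate_succ_apply']
        simp [vertNext, X.invol₂]
      · exact ⟨m, Or.inr rfl⟩
    · rcases hbc with rfl | rfl
      -- Here one steps back by `r₁ ∘ r₂`, the inverse of `vertNext`; adding the degree keeps the
      -- exponent a natural number even for `m = 0`.
      · refine ⟨m + X.vertDeg x - 1, Or.inl ?_⟩
        have hN := X.vertDeg_pos x
        have e : X.vertNext^[m] x = X.vertNext (X.vertNext^[m + X.vertDeg x - 1] x) := by
          rw [← Function.iterate_succ_apply' X.vertNext,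
            show (m + X.vertDeg x - 1).succ = m + X.vertDeg x by omega]
          exact Function.iterate_add_minimalPeriod_eq.symm
        rw [e]
        simp [vertNext, X.invol₁, X.invol₂]
      · exact ⟨m, Or.inl (X.invol₂ _)⟩

variable {X}

theorem DimerConfig.mem_rev_iff (D : X.DimerConfig) (x : Φ) :
    X.rev x ∈ D.carrier ↔ x ∈ D.carrier := by
  have h : ∀ x, x ∈ D.carrier → X.rev x ∈ D.carrier := fun x hx => D.mem_r₂ _ (D.mem_r₀ _ hx)
  exact ⟨fun hx => by simpa using h _ hx, h x⟩

theorem DimerConfig.exists_vertNext_iterate_mem [Finite Φ] (D : X.DimerConfig) (x : Φ) :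
    ∃ m, X.vertNext^[m] x ∈ D.carrier := by
  obtain ⟨z, hz, hxz, -⟩ := D.exactly_one x
  obtain ⟨m, rfl | rfl⟩ := X.exists_vertNext_iterate_of_sameVertex hxz
  · exact ⟨m, hz⟩
  · exact ⟨m, by simpa [X.invol₂] using D.mem_r₂ _ hz⟩

theorem sameVertex_vertNext_iterate (x : Φ) (m : ℕ) : X.SameVertex x (X.vertNext^[m] x) := by
  induction m with
  | zero => exact .refl
  | succ m ih =>
    rw [Function.iterate_succ_apply']
    exact (ih.tail (Or.inl rfl)).tail (Or.inr rfl)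

/-- The dimer at a vertex is met only once when going around it. -/
theorem DimerConfig.vertNext_iterate_notMem (D : X.DimerConfig) {x : Φ} (hx : x ∈ D.carrier)
    {m : ℕ} (h0 : 0 < m) (hm : m < X.vertDeg x) : X.vertNext^[m] x ∉ D.carrier := by
  intro h
  obtain ⟨z, hz, hxz, huniq⟩ := D.exactly_one x
  have hne : X.vertNext^[m] x ≠ x := fun h' =>
    Function.not_isPeriodicPt_of_pos_of_lt_minimalPeriod h0.ne' hm h'
  have hne' := X.vertNext_iterate_ne m x
  rcases huniq x hx .refl with rfl | h1
  · rcases huniq _ h (sameVertex_vertNext_iterate _ m) with h2 | h2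
    · exact hne h2
    · exact hne' h2
  · have h1' : X.r₂ x = z := by rw [h1, X.invol₂]
    rcases huniq _ h (sameVertex_vertNext_iterate _ m) with h2 | h2
    · exact hne' (h2.trans h1'.symm)
    · exact hne (h2.trans h1.symm)

/-! ### Angles from an edge-end to the dimer -/

/-- The number of edge-ends met before the dimer when going around a vertex. -/
def dimerSteps (D : X.DimerConfig) (x : Φ) : ℕ := sInf {m : ℕ | X.vertNext^[m] x ∈ D.carrier}

theorem dimerAngle_eq (α : X.CornerAngles) (D : X.DimerConfig) (y : Φ × ZMod 2) :
    dimerAngle α D y =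
      ∑ j ∈ Finset.range (dimerSteps D y.1), α.angle (X.vertNext^[j] y.1) := by
  simp [dimerAngle, dimerSteps]

/-- The infimum is taken over a nonempty set, so its default value 0 plays no role. -/
theorem vertNext_iterate_dimerSteps_mem [Finite Φ] (D : X.DimerConfig) (x : Φ) :
    X.vertNext^[dimerSteps D x] x ∈ D.carrier :=
  Nat.sInf_mem (s := {m : ℕ | X.vertNext^[m] x ∈ D.carrier}) (D.exists_vertNext_iterate_mem x)

theorem dimerSteps_le (D : X.DimerConfig) {x : Φ} {m : ℕ} (h : X.vertNext^[m] x ∈ D.carrier) :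
    dimerSteps D x ≤ m :=
  Nat.sInf_le h

theorem dimerSteps_lt_vertDeg [Finite Φ] (D : X.DimerConfig) (x : Φ) :
    dimerSteps D x < X.vertDeg x := by
  obtain ⟨m, hm⟩ := D.exists_vertNext_iterate_mem x
  refine (dimerSteps_le D (m := m % X.vertDeg x) ?_).trans_lt (Nat.mod_lt _ (X.vertDeg_pos x))
  rwa [vertDeg, Function.iterate_mod_minimalPeriod_eq]

theorem dimerSteps_eq_zero (D : X.DimerConfig) {x : Φ} (h : x ∈ D.carrier) : dimerSteps D x = 0 :=
  Nat.le_zero.mp (dimerSteps_le D (m := 0) h)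

theorem dimerSteps_of_notMem [Finite Φ] (D : X.DimerConfig) {x : Φ} (h : x ∉ D.carrier) :
    dimerSteps D x = dimerSteps D (X.vertNext x) + 1 := by
  have h1 := vertNext_iterate_dimerSteps_mem D x
  have h2 := vertNext_iterate_dimerSteps_mem D (X.vertNext x)
  rw [← Function.iterate_succ_apply] at h2
  refine le_antisymm (dimerSteps_le D h2) ?_
  obtain ⟨m, hm⟩ : ∃ m, dimerSteps D x = m + 1 := by
    refine Nat.exists_eq_succ_of_ne_zero fun h0 => h ?_
    simpa [h0] using h1
  rw [hm, Function.iterate_succ_apply] at h1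
  rw [hm]
  exact Nat.succ_le_succ (dimerSteps_le D h1)

/-- Uniqueness of the dimer at a vertex enters here: after leaving it one must go all the way around
before meeting it again. -/
theorem dimerSteps_vertNext_of_mem [Finite Φ] (D : X.DimerConfig) {x : Φ} (h : x ∈ D.carrier) :
    dimerSteps D (X.vertNext x) + 1 = X.vertDeg x := by
  have hN := X.vertDeg_pos x
  have h2 := vertNext_iterate_dimerSteps_mem D (X.vertNext x)
  rw [← Function.iterate_succ_apply] at h2
  refine le_antisymm ?_ ?_
  · have : dimerSteps D (X.vertNext x) ≤ X.vertDeg x - 1 := by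
      refine dimerSteps_le D ?_
      rw [← Function.iterate_succ_apply, show (X.vertDeg x - 1).succ = X.vertDeg x by omega,
        vertDeg, Function.iterate_minimalPeriod]
      exact h
    omega
  · by_contra hlt
    exact D.vertNext_iterate_notMem h (Nat.succ_pos _) (not_le.mp hlt) h2

/-- `2π` if the edge does not belong to the dimer configuration, and `0` if it does. -/
def fullTurn (D : X.DimerConfig) (x : Φ) : ℝ :=
  open Classical in if x ∈ D.carrier then 0 else 2 * Real.pi

theorem fullTurn_rev (D : X.DimerConfig) (x : Φ) : fullTurn D (X.rev x) = fullTurn D x := by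
  by_cases h : x ∈ D.carrier <;> simp [fullTurn, D.mem_rev_iff, h]

theorem dimerAngle_of_mem (α : X.CornerAngles) (D : X.DimerConfig) {y : Φ × ZMod 2}
    (h : y.1 ∈ D.carrier) : dimerAngle α D y = 0 := by
  rw [dimerAngle_eq, dimerSteps_eq_zero D h, Finset.sum_range_zero]

theorem dimerAngle_nonneg (α : X.CornerAngles) (D : X.DimerConfig) (y : Φ × ZMod 2) :
    0 ≤ dimerAngle α D y := by
  rw [dimerAngle_eq]
  exact Finset.sum_nonneg fun j _ => (α.pos _).le

theorem dimerAngle_lt [Finite Φ] (α : X.CornerAngles) (D : X.DimerConfig) (y : Φ × ZMod 2) :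
    dimerAngle α D y < 2 * Real.pi := by
  rw [dimerAngle_eq, ← α.sum_eq y.1]
  have h := dimerSteps_lt_vertDeg D y.1
  refine Finset.sum_lt_sum_of_subset (Finset.range_mono h.le) (Finset.mem_range.mpr h) (by simp)
    (α.pos _) fun j _ _ => (α.pos _).le

/-- The relation between the dimer angles at two consecutive edge-ends. -/
theorem angle_add_dimerAngle_vertNext [Finite Φ] (α : X.CornerAngles) (D : X.DimerConfig) (x : Φ)
    (a : ZMod 2) : α.angle x + dimerAngle α D (X.vertNext x, a) =
      dimerAngle α D (x, a) + 2 * Real.pi - fullTurn D x := by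
  simp only [dimerAngle_eq]
  have key : α.angle x + ∑ j ∈ Finset.range (dimerSteps D (X.vertNext x)),
      α.angle (X.vertNext^[j] (X.vertNext x)) =
      ∑ j ∈ Finset.range (dimerSteps D (X.vertNext x) + 1), α.angle (X.vertNext^[j] x) := by
    rw [Finset.sum_range_succ', add_comm]
    rfl
  rw [key]
  -- From a dimer the left side is the whole angle 2π; otherwise adding the corner merely lengthens
  -- the sum by its first term.
  by_cases h : x ∈ D.carrier
  · rw [dimerSteps_vertNext_of_mem D h, α.sum_eq, dimerSteps_eq_zero D h]
    simp [fullTurn, h]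
  · rw [← dimerSteps_of_notMem D h]
    simp [fullTurn, h]

theorem dimerAngle_pos [Finite Φ] (α : X.CornerAngles) (D : X.DimerConfig) {y : Φ × ZMod 2}
    (h : y.1 ∉ D.carrier) : 0 < dimerAngle α D y := by
  rw [dimerAngle_eq, dimerSteps_of_notMem D h]
  exact Finset.sum_pos (fun j _ => α.pos _) (by simp)

theorem toIcoMod_dimerAngle [Finite Φ] (α : X.CornerAngles) (D : X.DimerConfig)
    (y : Φ × ZMod 2) :
    toIcoMod Real.two_pi_pos 0 (dimerAngle α D y) = dimerAngle α D y := by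
  rw [toIcoMod_eq_self]
  exact ⟨dimerAngle_nonneg α D y, by simpa using dimerAngle_lt α D y⟩

/-- The representative of -a in [0, 2π) is 2π - a unless a = 0, which happens exactly when the edge
is a dimer. This jump is how the dimers enter the signs. -/
theorem toIcoMod_neg_dimerAngle [Finite Φ] (α : X.CornerAngles) (D : X.DimerConfig)
    (y : Φ × ZMod 2) :
    toIcoMod Real.two_pi_pos 0 (-dimerAngle α D y) = fullTurn D y.1 - dimerAngle α D y := by
  by_cases h : y.1 ∈ D.carrier
  · simp [fullTurn, h, dimerAngle_of_mem α D h]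
  · rw [← toIcoMod_add_right, fullTurn, if_neg h,
      show -dimerAngle α D y + 2 * Real.pi = 2 * Real.pi - dimerAngle α D y by ring,
      toIcoMod_eq_self]
    constructor
    · linarith [dimerAngle_lt α D y]
    · linarith [dimerAngle_pos α D h]

/-! ### Labels and curvature -/

variable {ω : Φ → ZMod 2}

theorem Labelling.sign_rev (σ : X.Labelling ω) (y : Φ × ZMod 2) :
    σ.sign (X.cover.rev y) = σ.sign (X.cover.r₀ y) := σ.sign_r₂ _

theorem Labelling.sign_faceNext (σ : X.Labelling ω) (y : Φ × ZMod 2) :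
    σ.sign (X.cover.faceNext y) = σ.sign (X.cover.r₀ y) := σ.sign_r₁ _

theorem Labelling.sign_deck_eq (σ : X.Labelling ω) (y : Φ × ZMod 2) :
    σ.sign (deck y) = σ.sign y + 1 := by
  have h : ∀ a b : ZMod 2, a ≠ b → a = b + 1 := by decide
  exact h _ _ (σ.sign_deck y)

/-- The labels change an even number of times around a face. -/
theorem Labelling.sum_sign (σ : X.Labelling ω) (y : Φ × ZMod 2) :
    ∑ k ∈ Finset.range (X.cover.faceLen y),
      (σ.sign (X.cover.faceNext^[k] y) + σ.sign (X.cover.r₀ (X.cover.faceNext^[k] y))) = 0 := by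
  rw [Finset.sum_add_distrib]
  have h := sum_range_succ_eq_of_periodic (fun k => σ.sign (X.cover.faceNext^[k] y))
    (X.cover.faceLen y) (congrArg σ.sign (X.cover.faceNext_iterate_faceLen y))
  simp only [Function.iterate_succ_apply', σ.sign_faceNext] at h
  rw [h, CharTwo.add_self_eq_zero]

/-- `0` if the edge of `x`, run through from the vertex of `x`, agrees with `K`, and `1` if not. -/
def disagree (K : X.EdgeOrientation) (x : Φ) : ZMod 2 :=
  open Classical in if K.tail x then 0 else 1

theorem disagree_r₀ (K : X.EdgeOrientation) (x : Φ) :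
    disagree K (X.r₀ x) = disagree K x + 1 := by
  by_cases h : K.tail x <;> simp [disagree, K.tail_r₀, h, CharTwo.add_self_eq_zero]

/-- The contribution of a side to the curvature. -/
def sideCurvature (σ : X.Labelling ω) (K : X.EdgeOrientation) (y : Φ × ZMod 2) : ZMod 2 :=
  disagree K y.1 + σ.sign y * σ.sign (X.cover.r₀ y)

theorem liftCurvature_eq_sum (σ : X.Labelling ω) (K : X.EdgeOrientation) (y : Φ × ZMod 2) :
    liftCurvature σ K y =
      ∑ k ∈ Finset.range (X.cover.faceLen y), sideCurvature σ K (X.cover.faceNext^[k] y) + 1 := by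
  have h : ∀ a b : ZMod 2, a * b = if a = 1 ∧ b = 1 then 1 else 0 := by decide
  simp only [liftCurvature, sideCurvature, Finset.sum_add_distrib, disagree, h,
    Finset.card_filter, Nat.cast_sum, Nat.cast_ite, Nat.cast_one, Nat.cast_zero, ite_not]

theorem liftCurvature_faceNext [Finite Φ] (σ : X.Labelling ω) (K : X.EdgeOrientation)
    (y : Φ × ZMod 2) : liftCurvature σ K (X.cover.faceNext y) = liftCurvature σ K y := by
  rw [liftCurvature_eq_sum, liftCurvature_eq_sum, X.cover.faceLen_faceNext]
  congr 1
  exact sum_range_succ_eq_of_periodic (fun k => sideCurvature σ K (X.cover.faceNext^[k] y))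
    (X.cover.faceLen y) (congrArg _ (X.cover.faceNext_iterate_faceLen y))

/-- Conjugation by `r₀` reverses the direction in which a face is run through. -/
theorem faceNext_iterate_r₀ (k : ℕ) (z : Φ) :
    X.faceNext^[k] (X.r₀ (X.faceNext^[k] z)) = X.r₀ z := by
  induction k generalizing z with
  | zero => rfl
  | succ k ih =>
    rw [Function.iterate_succ_apply', Function.iterate_succ_apply, ih]
    simp [faceNext, X.invol₀, X.invol₁]

theorem faceLen_r₀ (x : Φ) : X.faceLen (X.r₀ x) = X.faceLen x := by
  have h : ∀ x n, Function.IsPeriodicPt X.faceNext n x →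
      Function.IsPeriodicPt X.faceNext n (X.r₀ x) := by
    intro x n hx
    have := faceNext_iterate_r₀ (X := X) n x
    rwa [hx] at this
  exact Function.minimalPeriod_eq_minimalPeriod_iff.mpr fun n =>
    ⟨fun hx => by simpa [X.invol₀] using h _ n hx, h x n⟩

/-- The flag `(r₀ x, a)` lies on the other lift of the edge, run through backwards: the ends are
exchanged, both labels flip, and agreement with `K` changes. -/
theorem sideCurvature_r₀ (σ : X.Labelling ω) (K : X.EdgeOrientation) (x : Φ) (a : ZMod 2) :
    sideCurvature σ K (X.r₀ x, a) = sideCurvature σ K (x, a) +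
      (σ.sign (x, a) + σ.sign (X.cover.r₀ (x, a))) := by
  have h1 : σ.sign (X.r₀ x, a) = σ.sign (X.cover.r₀ (x, a)) + 1 := by
    rw [← σ.sign_deck_eq]
    simp [deck, cover, add_assoc, CharTwo.add_self_eq_zero]
  have h2 : σ.sign (X.cover.r₀ (X.r₀ x, a)) = σ.sign (x, a) + 1 := by
    rw [← σ.sign_deck_eq]
    simp [deck, cover, X.invol₀]
  have h3 : ∀ d e e' : ZMod 2, d + 1 + (e' + 1) * (e + 1) = d + e * e' + (e + e') := by decide
  simp only [sideCurvature, disagree_r₀, h1, h2, h3]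

/-- Independence of the lift: the sides correspond in reverse order, and the corrections of
`sideCurvature_r₀` add up to 0 by `sum_sign`. -/
theorem liftCurvature_r₀ (σ : X.Labelling ω) (K : X.EdgeOrientation) (x : Φ) (a : ZMod 2) :
    liftCurvature σ K (X.r₀ x, a) = liftCurvature σ K (x, a) := by
  have hs := σ.sum_sign (x, a)
  simp only [liftCurvature_eq_sum, cover_faceNext_iterate, cover_faceLen, faceLen_r₀] at hs ⊢
  congr 1
  set n := X.faceLen x with hn
  -- The side number `k` from `r₀ x` is the reverse of the side number `n - k` from `x`, written so
  -- that a reflection of the range followed by a cyclic shift restores the sum.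
  have h1 : ∀ k ∈ Finset.range n, sideCurvature σ K (X.faceNext^[k] (X.r₀ x), a) =
      sideCurvature σ K (X.r₀ (X.faceNext^[n - 1 - k + 1] x), a) := by
    intro k hk
    have hk' := Finset.mem_range.mp hk
    have e : x = X.faceNext^[k] (X.faceNext^[n - 1 - k + 1] x) := by
      rw [← Function.iterate_add_apply, show k + (n - 1 - k + 1) = n by omega, hn,
        faceNext_iterate_faceLen]
    conv_lhs => rw [e, faceNext_iterate_r₀]
  rw [Finset.sum_congr rfl h1,
    Finset.sum_range_reflect (fun k => sideCurvature σ K (X.r₀ (X.faceNext^[k + 1] x), a)) n,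
    sum_range_succ_eq_of_periodic (fun k => sideCurvature σ K (X.r₀ (X.faceNext^[k] x), a)) n
      (by simp [hn])]
  simp only [sideCurvature_r₀]
  rw [Finset.sum_add_distrib, hs, add_zero]

/-- The curvature can be computed on any lift of the face, from any of its flags. -/
theorem curvature_faceOf [Finite Φ] (σ : X.Labelling ω) (K : X.EdgeOrientation) (x : Φ) :
    curvature σ K (X.faceOf x) = liftCurvature σ K (x, 0) := by
  -- The curvature of a positive flag descends to faces: `r₀` changes the lift, and `r₁ x = faceNext
  -- (r₀ x)`. So the flag picked by `Quot.out` is irrelevant.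
  let F : X.Face → ZMod 2 := Quot.lift (fun x => liftCurvature σ K (x, 0)) (by
    rintro x _ (rfl | rfl)
    · exact (liftCurvature_r₀ σ K x 0).symm
    · have h := liftCurvature_faceNext σ K (X.r₀ x, 0)
      rw [cover_faceNext, liftCurvature_r₀] at h
      simpa [faceNext, X.invol₀] using h.symm)
  have h1 : curvature σ K (X.faceOf x) = F (Quot.mk _ (Quot.out (X.faceOf x))) := rfl
  exact h1.trans (congrArg F (Quot.out_eq (X.faceOf x)))

end CellDecomp

end Kasteleyn

end

/-! ### The lift of the framing to the unit quaternions -/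

noncomputable section

namespace Kasteleyn

theorem rotZ_add (a b : ℝ) : rotZ (a + b) = rotZ a * rotZ b := by
  simp only [← spinCover_quatZ, quatZ_add, map_mul]

theorem rotZ_zero : rotZ 0 = 1 := by
  rw [← spinCover_quatZ, quatZ_zero, map_one]

theorem rotZ_two_pi : rotZ (2 * Real.pi) = 1 := by
  rw [← spinCover_quatZ, quatZ_two_pi, spinCover_neg, map_one]

@[fun_prop]
theorem continuous_progress (i : ℕ) : Continuous (progress i) := by
  unfold progress
  fun_prop

theorem progress_zero (i : ℕ) : progress i 0 = 0 := by
  simp [progress]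

theorem progress_one {i : ℕ} (hi : i ≤ 2) : progress i 1 = 1 := by
  have : (i : ℝ) ≤ 2 := by exact_mod_cast hi
  rw [progress, min_eq_left (by linarith), max_eq_right zero_le_one]

/-- Gluing functions on `[0, 1]` with matching ends to a function on `[0, m]`. -/
theorem continuousOn_floor_glue {Y : Type*} [TopologicalSpace Y] (F : ℕ → ℝ → Y)
    (hF : ∀ k, Continuous (F k)) (h : ∀ k, F k 1 = F (k + 1) 0) (m : ℕ) :
    ContinuousOn (fun u : ℝ => F ⌊u⌋₊ (u - ⌊u⌋₊)) (Set.Icc 0 m) := by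
  induction m with
  | zero => simp
  | succ m ih =>
    have hpiece : ContinuousOn (fun u : ℝ => F ⌊u⌋₊ (u - ⌊u⌋₊))
        (Set.Icc (m : ℝ) ((m : ℝ) + 1)) := by
      have hc : ContinuousOn (fun u : ℝ => F m (u - m)) (Set.Icc (m : ℝ) ((m : ℝ) + 1)) :=
        ((hF m).comp (by fun_prop)).continuousOn
      refine hc.congr fun u hu => ?_
      rcases hu.2.lt_or_eq with hlt | heq
      · have : ⌊u⌋₊ = m := (Nat.floor_eq_iff ((Nat.cast_nonneg m).trans hu.1)).mpr ⟨hu.1, hlt⟩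
        simp only [this]
      · have h1 : ⌊u⌋₊ = m + 1 := by
          rw [heq]
          exact_mod_cast Nat.floor_natCast (R := ℝ) (m + 1)
        simp only [h1]
        rw [heq, Nat.cast_succ, sub_self, add_sub_cancel_left, h]
    rw [Nat.cast_succ, ← Set.Icc_union_Icc_eq_Icc (Nat.cast_nonneg m)
      (by linarith : (m : ℝ) ≤ m + 1)]
    exact ih.union_of_isClosed hpiece isClosed_Icc isClosed_Icc

namespace CellDecomp

variable {Φ : Type*} {X : CellDecomp Φ} {ω : Φ → ZMod 2}

/-- The lift of `vertexFraming`. -/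
def vertexQuat (α : X.CornerAngles) (σ : X.Labelling ω) (D : X.DimerConfig)
    (y : Φ × ZMod 2) : UnitQuaternion :=
  quatZ (dimerAngle α D y) * (if σ.sign y = 0 then 1 else quatX Real.pi)

theorem spinCover_vertexQuat (α : X.CornerAngles) (σ : X.Labelling ω) (D : X.DimerConfig)
    (y : Φ × ZMod 2) : spinCover (vertexQuat α σ D y) = vertexFraming α σ D y := by
  rw [vertexQuat, vertexFraming, map_mul, spinCover_quatZ]
  split_ifs
  · rw [map_one]
  · rw [spinCover_quatX]

/-- The lift of `forwardFraming`. -/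
def forwardQuat (α : X.CornerAngles) (σ : X.Labelling ω) (D : X.DimerConfig)
    (y : Φ × ZMod 2) (t : ℝ) : UnitQuaternion :=
  let a := dimerAngle α D y
  let b := Real.pi + dimerAngle α D (X.cover.rev y)
  let ε := σ.sign y
  let ε' := σ.sign (X.cover.rev y)
  if ω y.1 = 0 then
    vertexQuat α σ D y
      * quatZ (progress 0 t * rightTurn ε a 0)
      * quatZ (-(progress 1 t * Real.pi))
      * quatZ (progress 2 t * rightTurn ε' Real.pi b)
  else
    vertexQuat α σ D y
      * quatZ (progress 0 t * rightTurn ε a 0)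
      * quatY (progress 1 t * Real.pi)
      * quatZ (-(progress 2 t * leftTurn ε' Real.pi b))

theorem spinCover_forwardQuat (α : X.CornerAngles) (σ : X.Labelling ω) (D : X.DimerConfig)
    (y : Φ × ZMod 2) (t : ℝ) : spinCover (forwardQuat α σ D y t) = forwardFraming α σ D y t := by
  simp only [forwardQuat, forwardFraming]
  split_ifs <;>
    simp only [map_mul, spinCover_quatZ, spinCover_quatY, spinCover_vertexQuat]

theorem continuous_forwardQuat (α : X.CornerAngles) (σ : X.Labelling ω) (D : X.DimerConfig)
    (y : Φ × ZMod 2) : Continuous (forwardQuat α σ D y) := by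
  change Continuous fun t => forwardQuat α σ D y t
  simp only [forwardQuat]
  split_ifs <;> fun_prop

theorem forwardQuat_zero (α : X.CornerAngles) (σ : X.Labelling ω) (D : X.DimerConfig)
    (y : Φ × ZMod 2) : forwardQuat α σ D y 0 = vertexQuat α σ D y := by
  have hY : quatY 0 = 1 := by
    apply UnitQuaternion.ext_coords <;>
      simp [quatY, unitQuaternion, Quaternion.re_one, Quaternion.imI_one, Quaternion.imJ_one,
        Quaternion.imK_one]
  simp only [forwardQuat, progress_zero, zero_mul, neg_zero, quatZ_zero, hY, mul_one, ite_self]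

/-- `1` if the edge does not belong to the dimer configuration, and `0` if it does. -/
def offDimer (D : X.DimerConfig) (x : Φ) : ZMod 2 :=
  open Classical in if x ∈ D.carrier then 0 else 1

theorem offDimer_rev (D : X.DimerConfig) (x : Φ) : offDimer D (X.rev x) = offDimer D x := by
  by_cases h : x ∈ D.carrier <;> simp [offDimer, D.mem_rev_iff, h]

theorem quatZ_fullTurn (D : X.DimerConfig) (x : Φ) :
    quatZ (fullTurn D x) = signQuat (offDimer D x) := by
  by_cases h : x ∈ D.carrier
  · simp [fullTurn, offDimer, signQuat, h, quatZ_zero]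
  · simp [fullTurn, offDimer, signQuat, h, quatZ_two_pi]

theorem quatZ_neg_fullTurn (D : X.DimerConfig) (x : Φ) :
    quatZ (-fullTurn D x) = signQuat (offDimer D x) := by
  by_cases h : x ∈ D.carrier
  · simp [fullTurn, offDimer, signQuat, h, quatZ_zero]
  · simp [fullTurn, offDimer, signQuat, h, quatZ_neg_two_pi]

/-! ### Signs along the edges -/

/-- The sign by which the lift of the framing along an edge, run through in the direction of `K̃`,
differs at the final vertex from the standard lift. -/
def forwardSign (σ : X.Labelling ω) (D : X.DimerConfig) (y : Φ × ZMod 2) : ZMod 2 :=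
  offDimer D y.1 + (1 + σ.sign y) * (1 + σ.sign (X.cover.r₀ y))

/-- Half turns around the first two axes invert rotations around the third, so everything collects
into one `quatZ`, where the initial dimer angle cancels and only a `fullTurn` is left over. Between
two + vertices the left-handed half twist turns by -π seen from above, while the change of reference
framing is a turn by +π; the difference 2π is an additional sign. Between two - vertices the twist
is seen from below and no such sign arises. -/
theorem forwardQuat_one [Finite Φ] (α : X.CornerAngles) (σ : X.Labelling ω) (D : X.DimerConfig)
    (y : Φ × ZMod 2) : forwardQuat α σ D y 1 =
      signQuat (forwardSign σ D y) * (quatZ Real.pi * vertexQuat α σ D (X.cover.rev y)) := by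
  have hsign : signQuat 1 = quatZ (-(2 * Real.pi)) := by
    rw [quatZ_neg_two_pi]; rfl
  have hrev : fullTurn D (X.cover.rev y).1 = fullTurn D y.1 := by
    rw [cover_rev]; exact fullTurn_rev D y.1
  have h01 : ∀ a : ZMod 2, a = 0 ∨ a = 1 := by decide
  have hω := σ.sign_r₀ y
  rw [← σ.sign_rev] at hω
  have e1 := toIcoMod_dimerAngle α D y
  have e2 := toIcoMod_neg_dimerAngle α D y
  have e3 := toIcoMod_dimerAngle α D (X.cover.rev y)
  have e4 := toIcoMod_neg_dimerAngle α D (X.cover.rev y)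
  rw [hrev] at e4
  have q1 := quatZ_fullTurn D y.1
  have q2 := quatZ_neg_fullTurn D y.1
  simp only [forwardQuat, vertexQuat, forwardSign, ← σ.sign_rev, progress_one le_rfl,
    progress_one zero_le_two, progress_one one_le_two, one_mul, rightTurn, leftTurn]
  generalize dimerAngle α D y = a at *
  generalize dimerAngle α D (X.cover.rev y) = a' at *
  generalize fullTurn D y.1 = d at *
  have z1 : ∀ c, quatX Real.pi * quatZ c = quatZ (-c) * quatX Real.pi := quatX_pi_mul_quatZ
  have t10 : (1 : ZMod 2) ≠ 0 := by decide
  rcases h01 (σ.sign y) with h | h <;> rcases h01 (σ.sign (X.cover.rev y)) with h' | h' <;>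
    rw [h, h'] at hω ⊢
  · rw [if_pos (hω.mp rfl)]
    simp only [if_true, zero_sub, add_sub_cancel_left, e2, e3, mul_one, add_zero]
    rw [signQuat_add, ← q1, hsign]
    simp only [← quatZ_add]
    congr 1; ring
  · rw [if_neg fun h0 => t10 (hω.mpr h0)]
    simp only [if_true, t10, if_false, zero_sub, e2, add_sub_cancel_left, e3, mul_one]
    rw [show offDimer D y.1 + (1 + 0) * (1 + 1) = offDimer D y.1 from by
      rw [show (1 + 0 : ZMod 2) * (1 + 1) = 0 from by decide, add_zero], ← q1,
      -- The half twist around the second axis factors into the half turn of the reference framing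
      -- and the half turn `quatX π` that flips the label.
      mul_assoc (quatZ a * quatZ (d - a)), quatY_pi_mul_quatZ, ← quatZ_pi_mul_quatX_pi]
    simp only [← mul_assoc, ← quatZ_add]
    congr 2; ring
  · rw [if_neg fun h0 => t10 (hω.mpr h0).symm]
    simp only [if_true, t10, if_false, sub_zero, e1, mul_one]
    rw [show Real.pi - (Real.pi + a') = -a' by ring, e4,
      show offDimer D y.1 + (1 + 1) * (1 + 0) = offDimer D y.1 from by
      rw [show (1 + 1 : ZMod 2) * (1 + 0) = 0 from by decide, add_zero], ← q2,
      mul_assoc (quatZ a), z1, ← mul_assoc (quatZ a), mul_assoc _ (quatX _), quatX_pi_mul_quatY_pi]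
    simp only [← quatZ_add]
    congr 1; ring
  · rw [if_pos (hω.mp rfl)]
    simp only [t10, if_false, sub_zero, e1]
    rw [show Real.pi - (Real.pi + a') = -a' by ring, e4,
      show offDimer D y.1 + (1 + 1) * (1 + 1) = offDimer D y.1 from by
      rw [show (1 + 1 : ZMod 2) * (1 + 1) = 0 from by decide, add_zero], ← q2]
    rw [mul_assoc, mul_assoc, mul_assoc, ← quatZ_add, ← quatZ_add, z1]
    simp only [← mul_assoc, ← quatZ_add]
    congr 2; ring

/-- The sign by which the lift of the framing along an oriented edge differs at the final vertex
from the standard lift. -/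
def edgeSign (σ : X.Labelling ω) (D : X.DimerConfig) (K : X.EdgeOrientation)
    (y : Φ × ZMod 2) : ZMod 2 :=
  disagree K y.1 + forwardSign σ D y

theorem forwardSign_rev (σ : X.Labelling ω) (D : X.DimerConfig) (y : Φ × ZMod 2) :
    forwardSign σ D (X.cover.rev y) = forwardSign σ D y := by
  rw [forwardSign, forwardSign, ← σ.sign_rev, X.cover.rev_rev, σ.sign_rev,
    mul_comm (1 + σ.sign (X.cover.r₀ y))]
  rw [cover_rev, offDimer_rev]

/-- The lift of `edgeFraming` that starts at the standard lift. -/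
def edgeQuat (α : X.CornerAngles) (σ : X.Labelling ω) (D : X.DimerConfig)
    (K : X.EdgeOrientation) (y : Φ × ZMod 2) (t : ℝ) : UnitQuaternion :=
  open Classical in
  if K.tail y.1 then forwardQuat α σ D y t
  else signQuat (1 + forwardSign σ D y) *
    (quatZ Real.pi * forwardQuat α σ D (X.cover.rev y) (1 - t))

theorem spinCover_edgeQuat (α : X.CornerAngles) (σ : X.Labelling ω) (D : X.DimerConfig)
    (K : X.EdgeOrientation) (y : Φ × ZMod 2) (t : ℝ) :
    spinCover (edgeQuat α σ D K y t) = edgeFraming α σ D K y t := by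
  simp only [edgeQuat, edgeFraming]
  split_ifs
  · exact spinCover_forwardQuat ..
  · rw [map_mul, spinCover_signQuat, one_mul, map_mul, spinCover_quatZ, spinCover_forwardQuat]

theorem continuous_edgeQuat (α : X.CornerAngles) (σ : X.Labelling ω) (D : X.DimerConfig)
    (K : X.EdgeOrientation) (y : Φ × ZMod 2) : Continuous (edgeQuat α σ D K y) := by
  have h1 := continuous_forwardQuat α σ D y
  have h2 := continuous_forwardQuat α σ D (X.cover.rev y)
  change Continuous fun t => edgeQuat α σ D K y t
  by_cases h : K.tail y.1
  · simpa only [edgeQuat, h, if_true] using h1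
  · simp only [edgeQuat, h, if_false]
    fun_prop

/-- Reversing an edge twice turns the reference framing by 2π, which is -1 upstairs. The prefactor
in `edgeQuat` compensates for this and for `forwardSign`; its summand 1 is what `disagree` counts at
the other end. -/
theorem edgeQuat_zero [Finite Φ] (α : X.CornerAngles) (σ : X.Labelling ω) (D : X.DimerConfig)
    (K : X.EdgeOrientation) (y : Φ × ZMod 2) : edgeQuat α σ D K y 0 = vertexQuat α σ D y := by
  by_cases h : K.tail y.1
  · simp only [edgeQuat, h, if_true, forwardQuat_zero]
  · simp only [edgeQuat, h, if_false, sub_zero, forwardQuat_one, forwardSign_rev, X.cover.rev_rev]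
    rw [← mul_assoc (quatZ Real.pi), signQuat_comm, mul_assoc, ← mul_assoc, ← signQuat_add,
      ← mul_assoc (quatZ Real.pi), ← quatZ_add, ← two_mul, quatZ_two_pi, add_assoc,
      CharTwo.add_self_eq_zero, add_zero, show signQuat 1 = -1 from rfl, ← mul_assoc, neg_mul_neg,
      one_mul, one_mul]

theorem edgeQuat_one [Finite Φ] (α : X.CornerAngles) (σ : X.Labelling ω) (D : X.DimerConfig)
    (K : X.EdgeOrientation) (y : Φ × ZMod 2) : edgeQuat α σ D K y 1 =
      signQuat (edgeSign σ D K y) * (quatZ Real.pi * vertexQuat α σ D (X.cover.rev y)) := by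
  by_cases h : K.tail y.1
  · simp only [edgeQuat, h, if_true, forwardQuat_one, edgeSign, disagree, zero_add]
  · simp only [edgeQuat, h, if_false, sub_self, forwardQuat_zero, edgeSign, disagree]

/-! ### Signs at the corners and around a face -/

/-- The lift of the framing along the `k`-th side of a face, in the constant framing. -/
def sideQuat (α : X.CornerAngles) (σ : X.Labelling ω) (D : X.DimerConfig)
    (K : X.EdgeOrientation) (y : Φ × ZMod 2) (k : ℕ) (t : ℝ) : UnitQuaternion :=
  quatZ (sideAngle α y k t) * edgeQuat α σ D K (X.cover.faceNext^[k] y) t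

theorem vertexQuat_rev_congr (α : X.CornerAngles) (σ : X.Labelling ω) (D : X.DimerConfig)
    (y : Φ × ZMod 2) : vertexQuat α σ D (X.cover.rev y) =
      quatZ (dimerAngle α D (X.cover.rev y)) *
        (if σ.sign (X.cover.faceNext y) = 0 then 1 else quatX Real.pi) := by
  rw [vertexQuat, σ.sign_rev, σ.sign_faceNext]

/-- The sign by which the lifts of the framing along two consecutive sides differ. -/
def cornerSign (σ : X.Labelling ω) (D : X.DimerConfig) (K : X.EdgeOrientation)
    (y : Φ × ZMod 2) (k : ℕ) : ZMod 2 :=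
  edgeSign σ D K (X.cover.faceNext^[k] y) + (1 + offDimer D (X.faceNext^[k + 1] y.1))

/-- At the corner the tangent turns by π minus the interior angle, whereas the lift carries the half
turn from reversing the incoming edge. Together with the two dimer angles this leaves 2π -
`fullTurn` of the outgoing edge, by `angle_add_dimerAngle_vertNext`. -/
theorem sideQuat_one [Finite Φ] (α : X.CornerAngles) (σ : X.Labelling ω) (D : X.DimerConfig)
    (K : X.EdgeOrientation) (y : Φ × ZMod 2) (k : ℕ) :
    sideQuat α σ D K y k 1 = signQuat (cornerSign σ D K y k) * sideQuat α σ D K y (k + 1) 0 := by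
  have hnext : X.cover.faceNext (X.cover.faceNext^[k] y) = X.cover.faceNext^[k + 1] y :=
    (Function.iterate_succ_apply' ..).symm
  have hang := angle_add_dimerAngle_vertNext α D (X.faceNext^[k + 1] y.1) y.2
  have hrev : X.cover.rev (X.cover.faceNext^[k] y) =
      (X.vertNext (X.faceNext^[k + 1] y.1), y.2) := by
    rw [Function.iterate_succ_apply', vertNext_faceNext]
    simp
  rw [sideQuat, sideQuat, edgeQuat_one, edgeQuat_zero, vertexQuat_rev_congr, vertexQuat, hnext,
    hrev, cornerSign, signQuat_add, signQuat_add, ← quatZ_neg_fullTurn,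
    show signQuat 1 = quatZ (2 * Real.pi) by rw [quatZ_two_pi]; rfl]
  rw [← mul_assoc (quatZ (sideAngle α y k 1)), signQuat_comm]
  simp only [mul_assoc]
  congr 1
  simp only [← mul_assoc, ← quatZ_add]
  congr 2
  have hs : sideAngle α y (k + 1) 0 =
      sideAngle α y k 1 + (Real.pi - α.angle (X.faceNext^[k + 1] y.1)) := by
    simp only [sideAngle, cover_faceNext_iterate]
    push_cast
    ring
  have hfn : X.cover.faceNext^[k + 1] y = (X.faceNext^[k + 1] y.1, y.2) := by simp
  rw [hs, hfn]
  linear_combination hang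

theorem continuous_sideQuat (α : X.CornerAngles) (σ : X.Labelling ω) (D : X.DimerConfig)
    (K : X.EdgeOrientation) (y : Φ × ZMod 2) (k : ℕ) : Continuous (sideQuat α σ D K y k) := by
  have h1 := continuous_edgeQuat α σ D K (X.cover.faceNext^[k] y)
  have h2 : Continuous (sideAngle α y k) := by
    unfold sideAngle
    fun_prop
  unfold sideQuat
  fun_prop

/-- The lift of `boundaryFraming`. -/
def boundaryQuat (α : X.CornerAngles) (σ : X.Labelling ω) (D : X.DimerConfig)
    (K : X.EdgeOrientation) (y : Φ × ZMod 2) (u : ℝ) : UnitQuaternion :=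
  signQuat (∑ j ∈ Finset.range ⌊u⌋₊, cornerSign σ D K y j) * sideQuat α σ D K y ⌊u⌋₊ (u - ⌊u⌋₊)

theorem spinCover_boundaryQuat (α : X.CornerAngles) (σ : X.Labelling ω) (D : X.DimerConfig)
    (K : X.EdgeOrientation) (y : Φ × ZMod 2) (u : ℝ) :
    spinCover (boundaryQuat α σ D K y u) = boundaryFraming α σ D K y u := by
  rw [boundaryQuat, map_mul, spinCover_signQuat, one_mul, sideQuat, map_mul, spinCover_quatZ,
    spinCover_edgeQuat, boundaryFraming]

theorem continuousOn_boundaryQuat [Finite Φ] (α : X.CornerAngles) (σ : X.Labelling ω)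
    (D : X.DimerConfig) (K : X.EdgeOrientation) (y : Φ × ZMod 2) (m : ℕ) :
    ContinuousOn (boundaryQuat α σ D K y) (Set.Icc 0 m) := by
  refine continuousOn_floor_glue
    (fun k t => signQuat (∑ j ∈ Finset.range k, cornerSign σ D K y j) * sideQuat α σ D K y k t)
    (fun k => ?_) (fun k => ?_) m
  · have := continuous_sideQuat α σ D K y k
    fun_prop
  · rw [sideQuat_one, Finset.sum_range_succ, signQuat_add, mul_assoc]

/-- The dimer term of each edge appears once along the edge and once at the corner before it, and
cancels after a cyclic shift. The rest is (1 + e)(1 + e') + 1 = ee' + e + e' on each side, with e +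
e' removed by `sum_sign`. -/
theorem sum_cornerSign (σ : X.Labelling ω) (D : X.DimerConfig)
    (K : X.EdgeOrientation) (y : Φ × ZMod 2) :
    ∑ j ∈ Finset.range (X.cover.faceLen y), cornerSign σ D K y j + 1 = liftCurvature σ K y := by
  rw [liftCurvature_eq_sum]
  congr 1
  have h1 := sum_range_succ_eq_of_periodic (fun k => offDimer D (X.faceNext^[k] y.1))
    (X.cover.faceLen y) (by simp)
  have h2 := σ.sum_sign y
  simp only [cornerSign, Finset.sum_add_distrib] at *
  rw [h1]
  rw [← Finset.sum_add_distrib] at h2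
  simp only [← Finset.sum_add_distrib]
  rw [← add_zero (∑ k ∈ Finset.range (X.cover.faceLen y),
    sideCurvature σ K (X.cover.faceNext^[k] y)), ← h2, ← Finset.sum_add_distrib]
  refine Finset.sum_congr rfl fun k _ => ?_
  have h3 : ∀ d o e e' : ZMod 2, d + (o + (1 + e) * (1 + e')) + (1 + o) =
    d + e * e' + (e + e') := by decide
  have h4 : offDimer D (X.faceNext^[k] y.1) = offDimer D (X.cover.faceNext^[k] y).1 := by simp
  simp only [edgeSign, forwardSign, sideCurvature, h4]
  exact h3 _ _ _ _

/-- The lift of the framing picks up the sign of the curvature around a face. -/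
theorem boundaryQuat_faceLen [Finite Φ] (α : X.CornerAngles) (σ : X.Labelling ω)
    (D : X.DimerConfig) (K : X.EdgeOrientation) (y : Φ × ZMod 2) :
    boundaryQuat α σ D K y (X.cover.faceLen y) =
      signQuat (liftCurvature σ K y) * boundaryQuat α σ D K y 0 := by
  have hn : (X.cover.faceLen y : ℝ) ≠ 0 := by
    simpa using (X.faceLen_pos y.1).ne'
  -- The floor at the endpoint is the number of sides, so the lift is evaluated at the start of the
  -- first side again, now with the tangent turned by 2π; this is the summand 1 of the curvature.
  have hs : sideAngle α y (X.cover.faceLen y) 0 = 2 * Real.pi + sideAngle α y 0 0 := by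
    have h0 : X.cover.faceNext^[X.cover.faceLen y] y = X.cover.faceNext^[0] y :=
      X.cover.faceNext_iterate_faceLen y
    simp only [sideAngle, h0]
    field_simp
    push_cast
    ring
  rw [boundaryQuat, boundaryQuat, Nat.floor_natCast, sub_self, Nat.floor_zero]
  simp only [Finset.range_zero, Finset.sum_empty, Nat.cast_zero, sub_zero]
  rw [sideQuat, sideQuat, edgeQuat_zero, edgeQuat_zero, hs, quatZ_add, quatZ_two_pi,
    X.cover.faceNext_iterate_faceLen, ← sum_cornerSign σ D, signQuat_add,
    show signQuat 0 = 1 from rfl, show signQuat 1 = -1 from rfl, one_mul,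
    Function.iterate_zero_apply]
  simp only [mul_assoc]

/-- The boundary loop and its lift. -/
theorem exists_boundaryLoop [Finite Φ] (α : X.CornerAngles) (σ : X.Labelling ω)
    (D : X.DimerConfig) (K : X.EdgeOrientation) (y : Φ × ZMod 2) :
    ∃ (γ : Path (1 : SO3) 1) (Γ : C(unitInterval, UnitQuaternion)), IsBoundaryLoop α σ D K y γ ∧
      Γ 0 = 1 ∧ (∀ t, spinCover (Γ t) = γ t) ∧ Γ 1 = signQuat (liftCurvature σ K y) := by
  have hmaps : ∀ t : unitInterval, (X.cover.faceLen y : ℝ) * t ∈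
      Set.Icc (0 : ℝ) (X.cover.faceLen y) := fun t =>
    ⟨mul_nonneg (Nat.cast_nonneg _) t.2.1, mul_le_of_le_one_right (Nat.cast_nonneg _) t.2.2⟩
  have hc : Continuous fun t : unitInterval => boundaryQuat α σ D K y (X.cover.faceLen y * t) :=
    (continuousOn_boundaryQuat α σ D K y _).comp_continuous (by fun_prop) hmaps
  let Γ : C(unitInterval, UnitQuaternion) :=
    ⟨fun t => (boundaryQuat α σ D K y 0)⁻¹ * boundaryQuat α σ D K y (X.cover.faceLen y * t),
      by fun_prop⟩
  have h0 : Γ 0 = 1 := by simp [Γ]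
  have h1 : Γ 1 = signQuat (liftCurvature σ K y) := by
    simp only [Γ, ContinuousMap.coe_mk, Set.Icc.coe_one, mul_one]
    rw [boundaryQuat_faceLen, ← signQuat_comm, inv_mul_cancel_left]
  refine ⟨⟨⟨fun t => spinCover (Γ t), continuous_spinCover.comp Γ.continuous⟩, ?_, ?_⟩, Γ, ?_, h0,
    fun t => rfl, h1⟩
  · simp [h0]
  · simp only [h1]
    exact spinCover_signQuat _
  · intro t
    change spinCover (Γ t) = _
    simp only [Γ, ContinuousMap.coe_mk]
    rw [map_mul, map_inv, spinCover_boundaryQuat, spinCover_boundaryQuat]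

end CellDecomp

end Kasteleyn

end

/-! ### Loops that extend to the disc -/

noncomputable section

namespace Kasteleyn

namespace CellDecomp

theorem boundaryPoint_add (n : ℕ) (u v : ℝ) :
    boundaryPoint n (u + v) = boundaryPoint n u * boundaryPoint n v := by
  rw [boundaryPoint, boundaryPoint, boundaryPoint, ← Complex.exp_add]
  congr 1
  push_cast
  ring

theorem boundaryPoint_zero (n : ℕ) : boundaryPoint n 0 = 1 := by
  simp [boundaryPoint]

theorem boundaryPoint_mul {n : ℕ} (hn : n ≠ 0) (t : ℝ) :
    boundaryPoint n (n * t) = boundaryPoint 1 t := by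
  have : (n : ℂ) ≠ 0 := by exact_mod_cast hn
  rw [boundaryPoint, boundaryPoint]
  congr 1
  push_cast
  field_simp

theorem boundaryPoint_one_one : boundaryPoint 1 1 = 1 := by
  simp [boundaryPoint, Complex.exp_two_pi_mul_I]

theorem boundaryPoint_self {n : ℕ} (hn : n ≠ 0) : boundaryPoint n n = 1 := by
  simpa [boundaryPoint_one_one] using boundaryPoint_mul hn 1

@[simp]
theorem norm_boundaryPoint (n : ℕ) (u : ℝ) : ‖boundaryPoint n u‖ = 1 := by
  have h : boundaryPoint n u = Complex.exp ((2 * Real.pi * u / n : ℝ) * Complex.I) := by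
    rw [boundaryPoint]
    push_cast
    rfl
  rw [h, Complex.norm_exp_ofReal_mul_I]

theorem boundaryPoint_mul_mem_closedBall (n : ℕ) (u : ℝ) {z : ℂ}
    (hz : z ∈ Metric.closedBall (0 : ℂ) 1) :
    boundaryPoint n u * z ∈ Metric.closedBall (0 : ℂ) 1 := by
  simpa using hz

@[fun_prop]
theorem continuous_boundaryPoint (n : ℕ) : Continuous (boundaryPoint n) := by
  unfold boundaryPoint
  fun_prop

/-- The parameters differ by an integer, which has absolute value at most one on the unit interval.
-/
theorem eq_or_of_boundaryPoint_eq {s t : unitInterval}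
    (h : boundaryPoint 1 s = boundaryPoint 1 t) : s = t ∨ (s = 0 ∧ t = 1) ∨ (s = 1 ∧ t = 0) := by
  obtain ⟨m, hm⟩ := Complex.exp_eq_exp_iff_exists_int.mp h
  have hpi : (2 * Real.pi * Complex.I : ℂ) ≠ 0 := Complex.two_pi_I_ne_zero
  have h1 : ((s : ℝ) : ℂ) = ((t : ℝ) : ℂ) + m := by
    apply mul_left_cancel₀ hpi
    rw [Nat.cast_one, div_one, div_one] at hm
    linear_combination hm
  have h2 : (s : ℝ) = t + m := by exact_mod_cast h1
  have hs := s.2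
  have ht := t.2
  have hm1 : (m : ℝ) ≤ 1 := by linarith [hs.2, ht.1]
  have hm2 : (-1 : ℝ) ≤ m := by linarith [hs.1, ht.2]
  have hm1' : m ≤ 1 := by exact_mod_cast hm1
  have hm2' : -1 ≤ m := by exact_mod_cast hm2
  obtain rfl | rfl | rfl : m = -1 ∨ m = 0 ∨ m = 1 := by omega
  · right; left
    push_cast at h2
    exact ⟨Subtype.ext (show (s : ℝ) = 0 by linarith [hs.1, ht.2]),
      Subtype.ext (show (t : ℝ) = 1 by linarith [hs.1, ht.2])⟩
  · left
    exact Subtype.ext (by simpa using h2)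
  · right; right
    push_cast at h2
    exact ⟨Subtype.ext (show (s : ℝ) = 1 by linarith [hs.2, ht.1]),
      Subtype.ext (show (t : ℝ) = 0 by linarith [hs.2, ht.1])⟩

/-- Polar coordinates on the closed unit disc. -/
def polarMap (p : unitInterval × unitInterval) : Metric.closedBall (0 : ℂ) 1 :=
  ⟨(p.1 : ℝ) * boundaryPoint 1 p.2, by
    simpa [abs_of_nonneg p.1.2.1] using p.1.2.2⟩

theorem continuous_polarMap : Continuous polarMap := by
  refine Continuous.subtype_mk ?_ _
  fun_prop

theorem polarMap_surjective : Function.Surjective polarMap := by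
  rintro ⟨z, hz⟩
  have hz1 : ‖z‖ ≤ 1 := by simpa using hz
  have harg := Complex.norm_mul_exp_arg_mul_I z
  have hpi := Real.pi_pos
  obtain ⟨t, ht, hexp⟩ : ∃ t : ℝ, t ∈ Set.Icc (0 : ℝ) 1 ∧
      boundaryPoint 1 t = Complex.exp (z.arg * Complex.I) := by
    rcases le_or_gt 0 z.arg with h | h
    · refine ⟨z.arg / (2 * Real.pi), ⟨by positivity, ?_⟩, ?_⟩
      · rw [div_le_one (by positivity)]
        linarith [Complex.arg_le_pi z]
      · rw [boundaryPoint]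
        congr 1
        push_cast
        field_simp
    · refine ⟨z.arg / (2 * Real.pi) + 1, ⟨?_, ?_⟩, ?_⟩
      · have : -1 ≤ z.arg / (2 * Real.pi) := by
          rw [le_div_iff₀ (by positivity)]
          linarith [Complex.neg_pi_lt_arg z]
        linarith
      · have : z.arg / (2 * Real.pi) ≤ 0 := div_nonpos_of_nonpos_of_nonneg h.le (by positivity)
        linarith
      · rw [boundaryPoint_add, boundaryPoint_one_one, mul_one, boundaryPoint]
        congr 1
        push_cast
        field_simp
  refine ⟨(⟨‖z‖, norm_nonneg z, hz1⟩, ⟨t, ht⟩), Subtype.ext ?_⟩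
  simp only [polarMap, hexp]
  exact harg

/-- A nullhomotopic loop extends to the disc. -/
theorem exists_continuousOn_disc_of_homotopic_refl {Y : Type*} [TopologicalSpace Y] {x : Y}
    {γ : Path x x} (h : Path.Homotopic γ (Path.refl x)) :
    ∃ g : ℂ → Y, ContinuousOn g (Metric.closedBall 0 1) ∧
      ∀ t : unitInterval, g (boundaryPoint 1 t) = γ t := by
  -- The homotopy runs from the constant path to the loop, so its parameter can serve as the radius
  -- and the centre of the disc receives the base point.
  obtain ⟨H⟩ := h.symm
  have hq : Topology.IsQuotientMap polarMap :=
    continuous_polarMap.isClosedMap.isQuotientMap continuous_polarMap polarMap_surjective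
  have hfib : ∀ p q, polarMap p = polarMap q → H p = H q := by
    rintro ⟨r, s⟩ ⟨r', s'⟩ hpq
    have hval : ((r : ℝ) : ℂ) * boundaryPoint 1 s = ((r' : ℝ) : ℂ) * boundaryPoint 1 s' :=
      congrArg Subtype.val hpq
    have hr : r = r' := by
      have := congrArg norm hval
      simp only [norm_mul, norm_boundaryPoint, mul_one, Complex.norm_real, Real.norm_eq_abs,
        abs_of_nonneg r.2.1, abs_of_nonneg r'.2.1] at this
      exact Subtype.ext this
    subst hr
    by_cases h0 : r = 0
    · subst h0
      simp
    · have hr0 : ((r : ℝ) : ℂ) ≠ 0 := by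
        intro h
        exact h0 (Subtype.ext (by exact_mod_cast h))
      rcases eq_or_of_boundaryPoint_eq (mul_left_cancel₀ hr0 hval) with
        rfl | ⟨rfl, rfl⟩ | ⟨rfl, rfl⟩
      · rfl
      · simp
      · simp
  let L : C(Metric.closedBall (0 : ℂ) 1, Y) :=
    hq.lift (f := ⟨polarMap, continuous_polarMap⟩) (H : C(unitInterval × unitInterval, Y)) hfib
  have hL : ∀ p, L (polarMap p) = H p := fun p => by
    have := hq.lift_comp (f := ⟨polarMap, continuous_polarMap⟩)
      (H : C(unitInterval × unitInterval, Y)) hfib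
    exact congrArg (fun F : C(unitInterval × unitInterval, Y) => F p) this
  classical
  refine ⟨fun z => if hz : z ∈ Metric.closedBall (0 : ℂ) 1 then L ⟨z, hz⟩ else x, ?_, ?_⟩
  · rw [continuousOn_iff_continuous_domRestrict]
    convert L.continuous using 1
    funext z
    simp [Set.domRestrict]
  · intro t
    have hmem : boundaryPoint 1 t ∈ Metric.closedBall (0 : ℂ) 1 := by simp
    have e : (⟨boundaryPoint 1 t, hmem⟩ : Metric.closedBall (0 : ℂ) 1) = polarMap (1, t) :=
      Subtype.ext (by simp [polarMap])
    simp only [hmem, dif_pos]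
    rw [e, hL]
    simp

/-- A loop that extends to the disc is nullhomotopic. -/
theorem homotopic_refl_of_continuousOn_disc {Y : Type*} [TopologicalSpace Y] {x : Y}
    {γ : Path x x} {g : ℂ → Y} (hg : ContinuousOn g (Metric.closedBall 0 1))
    (h : ∀ t : unitInterval, g (boundaryPoint 1 t) = γ t) : Path.Homotopic γ (Path.refl x) := by
  have : ContractibleSpace (Metric.closedBall (0 : ℂ) 1) :=
    (convex_closedBall 0 1).contractibleSpace ⟨0, by simp⟩
  let b : Metric.closedBall (0 : ℂ) 1 := ⟨1, by simp⟩
  let c : Path b b :=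
    { toFun := fun t => ⟨boundaryPoint 1 t, by simp⟩
      continuous_toFun := Continuous.subtype_mk (by fun_prop) fun t => by simp
      source' := Subtype.ext (by simp [b, boundaryPoint_zero])
      target' := Subtype.ext (by simp [b, boundaryPoint_one_one]) }
  have h1 : Path.Homotopic c (Path.refl b) := SimplyConnectedSpace.paths_homotopic _ _
  have h2 := h1.map ⟨_, continuousOn_iff_continuous_domRestrict.mp hg⟩
  have hb : x = g 1 := by
    rw [← boundaryPoint_zero 1]
    simpa using (h 0).symm
  have h3 := h2.pathCast hb hb
  convert h3 using 1
  · ext t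
    exact (h t).symm
  · ext t
    exact hb

/-! ### Extending the framing over the faces -/

variable {Φ : Type*} {X : CellDecomp Φ} {ω : Φ → ZMod 2}

/-- This is the gluing condition of `IsFraming` for the framing `s` itself: both descriptions of an
edge differ by the half turn of the reference framing. -/
theorem edgeFraming_rev (α : X.CornerAngles) (σ : X.Labelling ω) (D : X.DimerConfig)
    (K : X.EdgeOrientation) (y : Φ × ZMod 2) (t : ℝ) :
    edgeFraming α σ D K y t = rotZ Real.pi * edgeFraming α σ D K (X.cover.rev y) (1 - t) := by
  have hK : K.tail (X.cover.rev y).1 ↔ ¬ K.tail y.1 := by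
    rw [cover_rev, rev, K.tail_r₂, K.tail_r₀]
  by_cases h : K.tail y.1
  · rw [edgeFraming, edgeFraming, if_pos h, if_neg (fun h' => hK.mp h' h), X.cover.rev_rev,
      ← mul_assoc, ← rotZ_add, ← two_mul, rotZ_two_pi, one_mul, sub_sub_cancel]
  · rw [edgeFraming, edgeFraming, if_neg h, if_pos (hK.mpr h)]

/-- The framing along the `k`-th side in the constant framing of the face. -/
theorem boundaryFraming_natCast_add [Finite Φ] (α : X.CornerAngles) (σ : X.Labelling ω)
    (D : X.DimerConfig) (K : X.EdgeOrientation) (y : Φ × ZMod 2) (k : ℕ) {t : ℝ}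
    (ht : t ∈ Set.Icc (0 : ℝ) 1) : boundaryFraming α σ D K y (k + t) =
      rotZ (sideAngle α y k t) * edgeFraming α σ D K (X.cover.faceNext^[k] y) t := by
  rcases ht.2.lt_or_eq with hlt | rfl
  · have hfl : ⌊(k : ℝ) + t⌋₊ = k := by
      rw [Nat.floor_eq_iff (by linarith [ht.1, Nat.cast_nonneg (α := ℝ) k])]
      constructor <;> linarith [ht.1]
    rw [boundaryFraming, hfl, add_sub_cancel_left]
  · have hfl : ⌊(k : ℝ) + 1⌋₊ = k + 1 := by
      exact_mod_cast Nat.floor_natCast (R := ℝ) (k + 1)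
    have h := congrArg spinCover (sideQuat_one α σ D K y k)
    rw [map_mul, spinCover_signQuat, one_mul] at h
    simp only [sideQuat, map_mul, spinCover_quatZ, spinCover_edgeQuat] at h
    rw [boundaryFraming, hfl, h, Nat.cast_succ, sub_self]

theorem cover_faceLen_iterate [Finite Φ] (y : Φ × ZMod 2) (k : ℕ) :
    X.cover.faceLen (X.cover.faceNext^[k] y) = X.cover.faceLen y :=
  Function.minimalPeriod_apply_iterate (X.cover.faceNext_injective.mem_periodicPts y) k

/-- Starting at another corner rotates the model disc by a multiple of 2π/n, which accounts for the
factor in `IsFraming.rotate`. -/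
theorem sideAngle_iterate [Finite Φ] (α : X.CornerAngles) (y : Φ × ZMod 2) (k : ℕ) (t : ℝ) :
    sideAngle α y k t =
      sideAngle α (X.cover.faceNext^[k] y) 0 t + 2 * Real.pi * k / X.cover.faceLen y := by
  have hl : X.cover.faceLen (X.cover.faceNext^[k] y) = X.cover.faceLen y :=
    cover_faceLen_iterate ..
  have hn : X.cover.faceNext^[0 + 1] (X.cover.faceNext^[k] y) = X.cover.faceNext^[k + 1] y := by
    rw [← Function.iterate_add_apply]
    congr 1
    omega
  simp only [sideAngle, hl, hn, Function.iterate_zero_apply]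
  push_cast
  ring

/-- A framing over the face is determined by its expression at one flag. -/
theorem IsFraming.iterate [Finite Φ] {α : X.CornerAngles} {G : Φ × ZMod 2 → ℂ → SO3}
    (hG : IsFraming α G) (y : Φ × ZMod 2) (hy : y.2 = 0) (k : ℕ) {z : ℂ}
    (hz : z ∈ Metric.closedBall (0 : ℂ) 1) :
    G (X.cover.faceNext^[k] y) z = rotZ (-(2 * Real.pi * k / X.cover.faceLen y)) *
      G y (boundaryPoint (X.cover.faceLen y) k * z) := by
  induction k generalizing z with
  | zero => simp [rotZ_zero, boundaryPoint_zero]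
  | succ k ih =>
    have hl : X.cover.faceLen (X.cover.faceNext^[k] y) = X.cover.faceLen y :=
      cover_faceLen_iterate ..
    rw [Function.iterate_succ_apply', hG.rotate _ (by simpa using hy) z hz, hl,
      ih (boundaryPoint_mul_mem_closedBall _ _ hz), ← mul_assoc, ← mul_assoc, ← rotZ_add,
      ← boundaryPoint_add, Nat.cast_succ]
    congr 2
    ring

/-- If the framing extends, then it is given around each face by the extension. -/
theorem boundaryFraming_eq_of_extends [Finite Φ] {α : X.CornerAngles} {σ : X.Labelling ω}
    {D : X.DimerConfig} {K : X.EdgeOrientation} {G : Φ × ZMod 2 → ℂ → SO3} (hG : IsFraming α G)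
    (hs : ∀ y, y.2 = 0 → ∀ t ∈ Set.Icc (0 : ℝ) 1,
      rotZ (-sideAngle α y 0 t) * G y (boundaryPoint (X.cover.faceLen y) t)
        = edgeFraming α σ D K y t)
    (y : Φ × ZMod 2) (hy : y.2 = 0) {u : ℝ} (hu : 0 ≤ u) :
    boundaryFraming α σ D K y u = G y (boundaryPoint (X.cover.faceLen y) u) := by
  have hl : X.cover.faceLen (X.cover.faceNext^[⌊u⌋₊] y) = X.cover.faceLen y :=
    cover_faceLen_iterate ..
  have ht : u - ⌊u⌋₊ ∈ Set.Icc (0 : ℝ) 1 :=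
    ⟨by linarith [Nat.floor_le hu], by linarith [Nat.lt_floor_add_one u]⟩
  rw [boundaryFraming, ← hs _ (by simpa using hy) _ ht, hl, hG.iterate y hy _ (by simp),
    sideAngle_iterate, ← boundaryPoint_add, ← mul_assoc, ← mul_assoc, ← rotZ_add, ← rotZ_add,
    add_sub_cancel]
  rw [show ∀ a b : ℝ, a + b + -a + -b = 0 by intros; ring, rotZ_zero, one_mul]

/-- Over a face without curvature the framing extends. -/
theorem exists_face_extension [Finite Φ] (α : X.CornerAngles) (σ : X.Labelling ω)
    (D : X.DimerConfig) (K : X.EdgeOrientation) (y : Φ × ZMod 2) {γ : Path (1 : SO3) 1}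
    (hγ : IsBoundaryLoop α σ D K y γ) (h : Path.Homotopic γ (Path.refl 1)) :
    ∃ g : ℂ → SO3, ContinuousOn g (Metric.closedBall 0 1) ∧
      ∀ u ∈ Set.Icc (0 : ℝ) (X.cover.faceLen y),
        g (boundaryPoint (X.cover.faceLen y) u) = boundaryFraming α σ D K y u := by
  obtain ⟨g, hg, hgγ⟩ := exists_continuousOn_disc_of_homotopic_refl h
  refine ⟨fun z => boundaryFraming α σ D K y 0 * g z, ?_, fun u hu => ?_⟩
  · exact continuousOn_const.mul hg
  · have hn : X.cover.faceLen y ≠ 0 := by simpa using (X.faceLen_pos y.1).ne'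
    have hn' : (0 : ℝ) < X.cover.faceLen y := by exact_mod_cast Nat.pos_of_ne_zero hn
    let t : unitInterval := ⟨u / X.cover.faceLen y, div_nonneg hu.1 hn'.le,
      (div_le_one hn').mpr hu.2⟩
    have hut : u = X.cover.faceLen y * (t : ℝ) := by
      simp only [t]
      field_simp
    beta_reduce
    rw [hut, boundaryPoint_mul hn, hgγ, hγ t, mul_inv_cancel_left]

variable (X) in
/-- The flags of a face with the same orientation character. -/
def orientedFaceSetoid [Finite Φ] : Setoid Φ where
  r x y := ∃ k, X.faceNext^[k] x = y
  iseqv :=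
    { refl := fun _ => ⟨0, rfl⟩
      symm := by
        rintro x _ ⟨k, rfl⟩
        -- Going back `k` steps is going forward up to the end of the `k`-th turn around the face.
        refine ⟨X.faceLen x * k - k, ?_⟩
        rw [← Function.iterate_add_apply,
          Nat.sub_add_cancel (Nat.le_mul_of_pos_left k (X.faceLen_pos x))]
        exact (Function.isPeriodicPt_minimalPeriod X.faceNext x).mul_const k
      trans := by
        rintro x _ _ ⟨k, rfl⟩ ⟨l, rfl⟩
        exact ⟨l + k, Function.iterate_add_apply ..⟩ }

variable (X) in
theorem exists_faceBase [Finite Φ] : ∃ r : Φ → Φ, (∀ x, r (X.faceNext x) = r x) ∧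
    ∀ x, ∃ k < X.faceLen (r x), X.faceNext^[k] (r x) = x := by
  let s := X.orientedFaceSetoid
  refine ⟨fun x => (Quotient.mk s x).out, fun x => ?_, fun x => ?_⟩
  · have : Quotient.mk s (X.faceNext x) = Quotient.mk s x :=
      (Quotient.sound (s := s) (⟨1, rfl⟩ : ∃ k, X.faceNext^[k] x = X.faceNext x)).symm
    simp only [this]
  · obtain ⟨k, hk⟩ : ∃ k, X.faceNext^[k] (Quotient.mk s x).out = x := Quotient.mk_out (s := s) x
    refine ⟨k % X.faceLen _, Nat.mod_lt _ (X.faceLen_pos _), ?_⟩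
    rwa [faceLen, Function.iterate_mod_minimalPeriod_eq]

/-- One extension per oriented face is kept, that of its base flag, and rotated by `k` sides to
serve the other flags. The choices over different flags of one face are thus compatible. -/
theorem framingExtends_of_face_extensions [Finite Φ] (α : X.CornerAngles) (σ : X.Labelling ω)
    (D : X.DimerConfig) (K : X.EdgeOrientation)
    (h : ∀ x : Φ, ∃ g : ℂ → SO3, ContinuousOn g (Metric.closedBall 0 1) ∧
      ∀ u ∈ Set.Icc (0 : ℝ) (X.faceLen x),
        g (boundaryPoint (X.faceLen x) u) = boundaryFraming α σ D K (x, 0) u) :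
    FramingExtends α σ D K := by
  obtain ⟨r, hr, hk⟩ := X.exists_faceBase
  choose k hkl hkr using hk
  choose g hgc hgb using h
  have hlen : ∀ x, X.faceLen (r x) = X.faceLen x := fun x => by
    conv_rhs => rw [← hkr x]
    exact (Function.minimalPeriod_apply_iterate (X.faceNext_injective.mem_periodicPts _) _).symm
  have hlen0 : ∀ x, X.faceLen x ≠ 0 := fun x => (X.faceLen_pos x).ne'
  let G : Φ × ZMod 2 → ℂ → SO3 := fun y z =>
    rotZ (-(2 * Real.pi * k y.1 / X.faceLen y.1)) *
      g (r y.1) (boundaryPoint (X.faceLen y.1) (k y.1) * z)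
  have hext : ∀ y : Φ × ZMod 2, y.2 = 0 → ∀ t ∈ Set.Icc (0 : ℝ) 1,
      rotZ (-sideAngle α y 0 t) * G y (boundaryPoint (X.cover.faceLen y) t)
        = edgeFraming α σ D K y t := by
    rintro ⟨x, a⟩ ha t ht
    obtain rfl : a = 0 := ha
    have hu : (k x : ℝ) + t ∈ Set.Icc (0 : ℝ) (X.faceLen (r x)) := by
      have h1 : (k x : ℝ) + 1 ≤ X.faceLen (r x) := by exact_mod_cast hkl x
      exact ⟨add_nonneg (Nat.cast_nonneg _) ht.1, by linarith [ht.2]⟩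
    have hit : X.cover.faceNext^[k x] (r x, 0) = (x, 0) := by simp [hkr]
    simp only [G, cover_faceLen]
    rw [← boundaryPoint_add, ← hlen x, hgb (r x) _ hu, boundaryFraming_natCast_add _ _ _ _ _ _ ht,
      sideAngle_iterate α (r x, 0) (k x), hit, cover_faceLen, ← mul_assoc, ← mul_assoc,
      ← rotZ_add, ← rotZ_add]
    rw [show ∀ a b : ℝ, -a + -b + (a + b) = 0 by intros; ring, rotZ_zero, one_mul]
  refine ⟨G, ⟨fun y _ => ?_, fun y _ z _ => ?_, fun y hy t ht => ?_⟩, hext⟩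
  · refine continuousOn_const.mul ((hgc _).comp (by fun_prop) fun z hz => ?_)
    exact boundaryPoint_mul_mem_closedBall _ _ hz
  -- The index of the next flag grows by one, or returns to 0 after the last side; in that case the
  -- rotations differ by a full turn, trivial in `SO3`.
  · have hcase : k (X.faceNext y.1) = k y.1 + 1 ∨
        (k (X.faceNext y.1) = 0 ∧ k y.1 + 1 = X.faceLen y.1) := by
      have h1 := hkr (X.faceNext y.1)
      have h2 : X.faceNext^[k y.1 + 1] (r y.1) = X.faceNext y.1 := by
        rw [Function.iterate_succ_apply', hkr]
      have h3 := hkl (X.faceNext y.1)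
      rw [hr] at h1 h3
      rcases (Nat.succ_le_of_lt (hkl y.1)).lt_or_eq with hlt | heq
      · left
        exact (Function.iterate_eq_iterate_iff_of_lt_minimalPeriod h3 hlt).mp (h1.trans h2.symm)
      · right
        refine ⟨?_, heq.trans (hlen _)⟩
        rw [show k y.1 + 1 = X.faceLen (r y.1) from heq, faceNext_iterate_faceLen] at h2
        exact (Function.iterate_eq_iterate_iff_of_lt_minimalPeriod h3 (X.faceLen_pos _)).mp
          (h1.trans h2.symm)
    have hn : (X.faceLen y.1 : ℝ) ≠ 0 := by exact_mod_cast hlen0 y.1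
    simp only [G, cover_faceNext, cover_faceLen, hr, faceLen_faceNext]
    rw [← mul_assoc, ← mul_assoc, ← rotZ_add, ← boundaryPoint_add]
    rcases hcase with hc | ⟨hc, hc'⟩
    · rw [hc, Nat.cast_succ]
      congr 2
      ring
    · have h4 : (k y.1 : ℝ) + 1 = X.faceLen y.1 := by exact_mod_cast hc'
      rw [hc, h4, boundaryPoint_self (hlen0 _), Nat.cast_zero, boundaryPoint_zero]
      congr 1
      have h5 : -(2 * Real.pi / X.faceLen y.1) + -(2 * Real.pi * k y.1 / X.faceLen y.1) =
          -(2 * Real.pi) := by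
        rw [show (k y.1 : ℝ) = X.faceLen y.1 - 1 by linarith]
        field_simp
        ring
      rw [h5, mul_zero, zero_div, neg_zero, rotZ_zero, eq_comm, ← mul_one (rotZ (-(2 * Real.pi))),
        ← rotZ_two_pi, ← rotZ_add, neg_add_cancel, rotZ_zero, rotZ_two_pi]
  · rw [hext y hy t ht, hext (X.cover.rev y) (by simpa using hy) (1 - t)
      ⟨by linarith [ht.2], by linarith [ht.1]⟩]
    exact edgeFraming_rev α σ D K y t

end CellDecomp

end Kasteleyn

end

/-! ### The obstruction class and the extension criterion -/

theorem mainTheorem7 {Φ : Type*} [Finite Φ] [Nonempty Φ]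
    (X : Kasteleyn.CellDecomp Φ) (hX : X.Connected) (α : X.CornerAngles)
    (ω : Φ → ZMod 2) (hω : X.RepresentsW1 ω) (σ : X.Labelling ω)
    (D : X.DimerConfig) (K : X.EdgeOrientation) :
    (∃ cls : FundamentalGroup Kasteleyn.SO3 1 ≃* Multiplicative (ZMod 2),
      ∀ (f : X.Face) (y : Φ × ZMod 2), y.2 = 0 → X.faceOf y.1 = f →
        ∃ γ : Path (1 : Kasteleyn.SO3) 1,
          Kasteleyn.CellDecomp.IsBoundaryLoop α σ D K y γ ∧
          cls (FundamentalGroup.fromPath (Path.Homotopic.Quotient.mk γ)) =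
            Multiplicative.ofAdd (Kasteleyn.CellDecomp.curvature σ K f)) ∧
    (Kasteleyn.CellDecomp.FramingExtends α σ D K ↔
      Kasteleyn.CellDecomp.IsKasteleyn σ K) := by
  obtain ⟨cls, hcls⟩ := Kasteleyn.exists_fundamentalGroup_equiv
  have hmain : ∀ x : Φ, ∃ γ : Path (1 : Kasteleyn.SO3) 1,
      Kasteleyn.CellDecomp.IsBoundaryLoop α σ D K (x, 0) γ ∧
      cls (FundamentalGroup.fromPath (Path.Homotopic.Quotient.mk γ)) =
        Multiplicative.ofAdd (Kasteleyn.CellDecomp.curvature σ K (X.faceOf x)) := by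
    intro x
    obtain ⟨γ, Γ, hγ, h0, hΓ, h1⟩ := Kasteleyn.CellDecomp.exists_boundaryLoop α σ D K (x, 0)
    rw [Kasteleyn.CellDecomp.curvature_faceOf]
    exact ⟨γ, hγ, hcls Γ γ _ h0 hΓ h1⟩
  refine ⟨⟨cls, ?_⟩, ?_, ?_⟩
  · rintro _ ⟨x, a⟩ ha rfl
    obtain rfl : a = 0 := ha
    exact hmain x
  · rintro ⟨G, hG, hs⟩ f
    obtain ⟨x, rfl⟩ : ∃ x, X.faceOf x = f := Quot.exists_rep f
    obtain ⟨γ, hγ, hc⟩ := hmain x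
    have hbf := fun u (hu : (0 : ℝ) ≤ u) =>
      Kasteleyn.CellDecomp.boundaryFraming_eq_of_extends hG hs (x, 0) rfl hu
    have hlen : X.cover.faceLen (x, 0) ≠ 0 := by simpa using (X.faceLen_pos x).ne'
    -- The extension over the disc, normalised to 1 at the base vertex, fills the boundary loop; its
    -- class is then trivial, and the class is the curvature.
    have hnull : Path.Homotopic γ (Path.refl 1) := by
      refine Kasteleyn.CellDecomp.homotopic_refl_of_continuousOn_disc
        (g := fun z => (Kasteleyn.CellDecomp.boundaryFraming α σ D K (x, 0) 0)⁻¹ * G (x, 0) z)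
        (continuousOn_const.mul (hG.continuousOn (x, 0) rfl)) fun t => ?_
      rw [hγ t, hbf _ (mul_nonneg (Nat.cast_nonneg _) t.2.1),
        Kasteleyn.CellDecomp.boundaryPoint_mul hlen]
    have hone : FundamentalGroup.fromPath (Path.Homotopic.Quotient.mk γ) = 1 :=
      Path.Homotopic.Quotient.eq.mpr hnull
    rw [hone, map_one] at hc
    exact (Multiplicative.ofAdd.injective hc).symm
  · intro hKast
    refine Kasteleyn.CellDecomp.framingExtends_of_face_extensions α σ D K fun x => ?_
    obtain ⟨γ, hγ, hc⟩ := hmain x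
    -- Injectivity of `cls` turns vanishing curvature into a null-homotopy, which fills the face.
    rw [hKast, ofAdd_zero, MulEquiv.map_eq_one_iff] at hc
    have hnull : Path.Homotopic γ (Path.refl 1) := Path.Homotopic.Quotient.eq.mp hc
    simpa using Kasteleyn.CellDecomp.exists_face_extension α σ D K (x, 0) hγ hnull
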